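/- Let $\mathbb{N}=\{1,2,\dots\}$ and $\mathbb{T}=\mathbb{R}/\mathbb{Z}$. Write $\mathcal{A}$ for the Borel $\sigma$-algebra of $\mathbb{R}^{\mathbb{Z}}$, $X_n(\omega)=\omega(n)$ for the coordinate projections, and $T$ for the shift $(T\omega)(n)=\omega(n+1)$ on $\mathbb{R}^{\mathbb{Z}}$. A finite non-negative Borel measure $\rho$ on $\mathbb{T}$ is symmetric if $\int_{\mathbb T} e^{2\pi i n x}\,d\rho(x)=\int_{\mathbb T} e^{-2\pi i n x}\,d\rho(x)$ for all $n\in\mathbb{Z}$. The Gaussian system associated with such a $\rho$ (its spectral measure) is $(\mathbb{R}^{\mathbb{Z}},\mathcal{A},\gamma,T)$, where $\gamma$ is the probability measure on $\mathcal{A}$ such that every element of the closed real linear span of $\{X_n : n\in\mathbb{Z}\}$ in $L^2(\gamma)$ has a Gaussian distribution with mean zero (variance zero being allowed) and $\int X_nX_m\,d\gamma=\int_{\mathbb{T}}e^{2\pi i(m-n)x}\,d\rho(x)$ for all $m,n\in\mathbb{Z}$. The system is non-trivial if $\rho\neq 0$. It is weakly mixing if $T$ preserves $\gamma$ and $\lim_{M\to\infty}\frac1M\sum_{n=1}^M|\gamma(A\cap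 T^{-n}B)-\gamma(A)\gamma(B)|=0$ for all $A,B\in\mathcal{A}$. **Theorem.** Let $N\in\mathbb{N}$, let $(m_k)_{k\in\mathbb{N}}$ be a strictly increasing sequence in $\mathbb{N}$ with $k!\mid m_k$ for each $k\in\mathbb{N}$, and let $v_1,\dots,v_N\in\mathbb{Z}[x]$ be polynomials that are linearly independent over $\mathbb{Q}$ and satisfy $v_j(0)=0$ for each $j\in\{1,\dots,N\}$. Then there exists a subsequence $(n_k)_{k\in\mathbb{N}}$ of $(m_k)_{k\in\mathbb{N}}$ such that for any $\xi=(\xi_1,\dots,\xi_N)\in\{0,1\}^N$ there exists a non-trivial weakly mixing Gaussian system $(\mathbb{R}^{\mathbb{Z}},\mathcal{A},\gamma_{\xi},T)$ with the property that for each $j\in\{1,\dots,N\}$ and any $A,B\in\mathcal{A}$, $$\lim_{k\to\infty}\gamma_{\xi}\bigl(A\cap T^{-v_j(n_k)}B\bigr)=(1-\xi_j)\,\gamma_{\xi}(A\cap B)+\xi_j\,\gamma_{\xi}(A)\,\gamma_{\xi}(B).$$ -/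

import Mathlib

open MeasureTheory ProbabilityTheory Filter Topology
open scoped Nat NNReal

noncomputable section

namespace GaussianSystem

/-- The coordinate projection `X_n : ℝ^ℤ → ℝ`. -/
def coord (n : ℤ) (ω : ℤ → ℝ) : ℝ := ω n

/-- The (invertible) shift `T` on `ℝ^ℤ`, `(T ω)(n) = ω (n + 1)`, as an element of the group of
permutations of `ℝ^ℤ`, so that `shift ^ a` is the iterate `T^a` for every `a : ℤ`. -/
def shift : Equiv.Perm (ℤ → ℝ) where
  toFun ω n := ω (n + 1)
  invFun ω n := ω (n - 1)
  left_inv ω := by funext n; simp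
  right_inv ω := by funext n; simp

/-- A Borel measure `ρ` on the circle `𝕋 = ℝ/ℤ` is symmetric if
`∫ e^{2πinx} dρ(x) = ∫ e^{-2πinx} dρ(x)` for every `n : ℤ`. -/
def IsSymmetric (ρ : Measure UnitAddCircle) : Prop :=
  ∀ n : ℤ, ∫ x, fourier n x ∂ρ = ∫ x, fourier (-n) x ∂ρ

/-- The space `H₁`: the closure in the real space `L²(γ)` of the linear span of the coordinate
projections. -/
def firstChaos (γ : Measure (ℤ → ℝ)) (h : ∀ n, MemLp (coord n) 2 γ) :
    Submodule ℝ (Lp ℝ 2 γ) :=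
  (Submodule.span ℝ (Set.range fun n : ℤ => (h n).toLp (coord n))).topologicalClosure

/-- `γ` is the Gaussian measure on `ℝ^ℤ` associated with the spectral measure `ρ`: it is a
probability measure, every element of `H₁` has a Gaussian distribution with mean zero (variance
zero is allowed), and `∫ X_n X_m dγ = ∫ e^{2πi(m-n)x} dρ(x)` for all `m, n : ℤ`.
The Gaussian system associated with `ρ` is `ℝ^ℤ` with its product σ-algebra, the measure `γ` and
the transformation `shift`. -/
structure IsGaussianMeasureOf (ρ : Measure UnitAddCircle) (γ : Measure (ℤ → ℝ)) : Prop where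
  isProbabilityMeasure : IsProbabilityMeasure γ
  memLp : ∀ n, MemLp (coord n) 2 γ
  gaussian : ∀ f ∈ firstChaos γ memLp, ∃ s : ℝ≥0, γ.map f = gaussianReal 0 s
  correlation : ∀ m n : ℤ,
    ((∫ ω, coord n ω * coord m ω ∂γ : ℝ) : ℂ) = ∫ x, fourier (m - n) x ∂ρ

/-- A transformation `T` of a probability space `(X, ν)` is weakly mixing if it preserves `ν` and
`(1/M) ∑_{n=1}^M |ν(A ∩ T^{-n}B) - ν(A)ν(B)| → 0` as `M → ∞`, for all measurable `A, B`. -/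
def IsWeaklyMixing {X : Type*} [MeasurableSpace X] (T : X → X) (ν : Measure X) : Prop :=
  MeasurePreserving T ν ν ∧
    ∀ A B : Set X, MeasurableSet A → MeasurableSet B →
      Tendsto (fun M : ℕ => (1 / (M : ℝ)) *
          ∑ n ∈ Finset.Icc 1 M, |ν.real (A ∩ T^[n] ⁻¹' B) - ν.real A * ν.real B|)
        atTop (𝓝 0)

end GaussianSystem

end

/-! A Gaussian system is governed by its covariances `c n = ∫ fourier n ∂ρ`. The correlation of two
exponentials of linear functionals is a fixed constant times the exponential of a covariance. Hence,
for `ξ ∈ {0, 1}`, the limits `c (s k + a) → (1 - ξ) * c a` for all `a` give the required limit along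
`s` for exponentials, and their density in `L²` carries it to all measurable sets
(`avgZero_correlation`).

It remains to find `ρ`. Take the law of `∑ ε_l δ_l` modulo `1`, with independent `ε_l` equal to `0,
0, 1, -1` with equal probability; then `c n = ∏ cos²(π n δ_l)` (`exists_measure_cosProduct`).
Suppose `v_j(n_k) δ_l` is an integer for `l < k`, tiny for `l > k`, and near `ξ_j / 2` modulo `1`
for `l = k`. Translation by `v_j(n_k)` then essentially affects only the `k`-th factor, which is
near `1` because `δ_k` is small: it survives if `ξ_j = 0` and is replaced by nearly `0` if `ξ_j = 1`
(`tendsto_cosProduct`).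

Such `δ_k` exist because each nontrivial integer combination of the polynomials is unbounded at
infinity, so that the curves `t ↦ (v_j(n) t)_j` over a short interval equidistribute in the torus
(`eventually_exists_approx`). Taking `δ_k` rational, the condition `k! ∣ m_k` lets later terms clear
its denominator, while sparseness makes its products with earlier values small
(`exists_subsequence_approx`). There are finitely many patterns `ξ`, so one subsequence serves them
all.

For weak mixing, a power `X^D` of larger degree is adjoined, always with target `1/2`. Then `c`
tends to zero along all translates of a sequence, which forces `ρ {0} = 0`; since `c ≥ 0`, the
Cesàro averages of `|c|` vanish (`isWeaklyMixing_shift`). -/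

noncomputable section

namespace GaussianSystem

/-! ### Vanishing averages over finite sets of times. -/

/-- The averages of `d` over the finite sets `F k` tend to zero as `k → ∞`. -/
def AvgZero (F : ℕ → Finset ℤ) (d : ℤ → ℝ) : Prop :=
  Tendsto (fun k => ((F k).card : ℝ)⁻¹ * ∑ n ∈ F k, d n) atTop (𝓝 0)

namespace AvgZero

variable {F : ℕ → Finset ℤ}

theorem zero : AvgZero F fun _ => 0 := by simp [AvgZero]

theorem add {d e : ℤ → ℝ} (hd : AvgZero F d) (he : AvgZero F e) :
    AvgZero F fun n => d n + e n := by
  simpa [AvgZero, Finset.sum_add_distrib, mul_add] using Tendsto.add hd he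

theorem const_mul {d : ℤ → ℝ} (c : ℝ) (hd : AvgZero F d) : AvgZero F fun n => c * d n := by
  simpa [AvgZero, ← Finset.mul_sum, mul_left_comm] using Tendsto.const_mul c hd

theorem mono {d e : ℤ → ℝ} (hd : AvgZero F d) (h0 : ∀ n, 0 ≤ e n) (h : ∀ n, e n ≤ d n) :
    AvgZero F e := by
  refine squeeze_zero (fun k => ?_) (fun k => ?_) hd
  · exact mul_nonneg (by positivity) (Finset.sum_nonneg fun n _ => h0 n)
  · exact mul_le_mul_of_nonneg_left (Finset.sum_le_sum fun n _ => h n) (by positivity)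

theorem of_approx {d : ℤ → ℝ} (h0 : ∀ n, 0 ≤ d n)
    (h : ∀ ε > 0, ∃ e : ℤ → ℝ, AvgZero F e ∧ ∀ n, d n ≤ e n + ε) : AvgZero F d := by
  refine Metric.tendsto_atTop.2 fun ε hε => ?_
  obtain ⟨e, he, hde⟩ := h (ε / 2) (by positivity)
  obtain ⟨K, hK⟩ := Metric.tendsto_atTop.1 he (ε / 2) (by positivity)
  refine ⟨K, fun k hk => ?_⟩
  have h1 := hK k hk
  rw [Real.dist_eq, sub_zero] at h1 ⊢
  have h2 : ((F k).card : ℝ)⁻¹ * ∑ n ∈ F k, d n ≤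
      ((F k).card : ℝ)⁻¹ * ∑ n ∈ F k, e n + ε / 2 := by
    calc _ ≤ ((F k).card : ℝ)⁻¹ * ∑ n ∈ F k, (e n + ε / 2) :=
          mul_le_mul_of_nonneg_left (Finset.sum_le_sum fun n _ => hde n) (by positivity)
      _ = ((F k).card : ℝ)⁻¹ * ∑ n ∈ F k, e n + ((F k).card : ℝ)⁻¹ * (F k).card * (ε / 2) := by
          rw [Finset.sum_add_distrib, Finset.sum_const, nsmul_eq_mul]; ring
      _ ≤ _ := by
          -- An inequality rather than an equality, because `F k` may be empty.
          have : ((F k).card : ℝ)⁻¹ * (F k).card ≤ 1 := inv_mul_le_one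
          nlinarith
  rw [abs_of_nonneg (mul_nonneg (by positivity) (Finset.sum_nonneg fun n _ => h0 n))]
  have := le_abs_self (((F k).card : ℝ)⁻¹ * ∑ n ∈ F k, e n)
  linarith

/-- Singletons turn averages into ordinary limits, so one argument covers both limits along a
sequence and the Cesàro means of weak mixing. -/
theorem singleton_iff {s : ℕ → ℤ} {d : ℤ → ℝ} :
    AvgZero (fun k => {s k}) d ↔ Tendsto (fun k => d (s k)) atTop (𝓝 0) := by
  simp [AvgZero]

/-- If a uniformly bounded sequence of seminorm-like functions averages to zero on a set with dense
span, then it averages to zero everywhere. -/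
theorem of_dense_span {E : Type*} [NormedAddCommGroup E] [NormedSpace ℂ E] {d : ℤ → E → ℝ}
    (C : ℝ) (h0 : ∀ n x, 0 ≤ d n x) (hadd : ∀ n x y, d n (x + y) ≤ d n x + d n y)
    (hsmul : ∀ n (c : ℂ) x, d n (c • x) ≤ ‖c‖ * d n x) (hbd : ∀ n x, d n x ≤ C * ‖x‖)
    {S : Set E} (hS : (Submodule.span ℂ S).topologicalClosure = ⊤)
    (h : ∀ x ∈ S, AvgZero F fun n => d n x) (x : E) : AvgZero F fun n => d n x := by
  have hspan : ∀ y ∈ Submodule.span ℂ S, AvgZero F fun n => d n y := by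
    intro y hy
    induction hy using Submodule.span_induction with
    | mem y hy => exact h y hy
    | zero => exact zero.mono (fun n => h0 n 0) fun n => by simpa using hbd n 0
    | add y z _ _ hy hz => exact (hy.add hz).mono (fun n => h0 n _) fun n => hadd n y z
    | smul c y _ hy => exact (hy.const_mul ‖c‖).mono (fun n => h0 n _) fun n => hsmul n c y
  refine of_approx (fun n => h0 n x) fun ε hε => ?_
  have hx : x ∈ closure (Submodule.span ℂ S : Set E) := by
    rw [← Submodule.topologicalClosure_coe, hS]; trivial
  obtain ⟨y, hy, hxy⟩ := Metric.mem_closure_iff.1 hx (ε / (|C| + 1)) (by positivity)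
  refine ⟨_, hspan y hy, fun n => ?_⟩
  have h1 : d n x ≤ d n y + d n (x - y) := by simpa using hadd n y (x - y)
  have h2 : d n (x - y) ≤ ε := by
    refine (hbd n _).trans ?_
    rw [dist_eq_norm] at hxy
    calc C * ‖x - y‖ ≤ (|C| + 1) * (ε / (|C| + 1)) := by
          gcongr; linarith [le_abs_self C]
      _ = ε := by field_simp
  linarith

end AvgZero

/-! ### Equidistribution in the torus and simultaneous approximation. -/

theorem integral_fourier_haarAddCircle {n : ℤ} (hn : n ≠ 0) :
    ∫ x : UnitAddCircle, fourier n x ∂AddCircle.haarAddCircle = 0 := by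
  have h := orthonormal_iff_ite.1 (orthonormal_fourier (T := 1)) 0 n
  rw [if_neg (Ne.symm hn)] at h
  simpa [fourierLp, ContinuousMap.inner_toLp] using h

/-- The normalized Haar measure of the torus. -/
abbrev torusMeasure (ι : Type*) [Fintype ι] : Measure (UnitAddTorus ι) :=
  Measure.pi fun _ => AddCircle.haarAddCircle

open UnitAddTorus in
theorem integral_mFourier {ι : Type*} [Fintype ι] {c : ι → ℤ} (hc : c ≠ 0) :
    ∫ x : UnitAddTorus ι, mFourier c x ∂torusMeasure ι = 0 := by
  simp only [mFourier, ContinuousMap.coe_mk]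
  rw [integral_fintype_prod_eq_prod (fun i (x : UnitAddCircle) => fourier (c i) x)]
  obtain ⟨i, hi⟩ := Function.ne_iff.1 hc
  exact Finset.prod_eq_zero (Finset.mem_univ i) (integral_fourier_haarAddCircle hi)

theorem norm_integral_exp_le {r lam : ℝ} (hl : lam ≠ 0) :
    ‖∫ t in (0 : ℝ)..r, Complex.exp (2 * Real.pi * lam * Complex.I * t)‖ ≤ 1 / |lam| := by
  have hne : (2 * Real.pi * lam * Complex.I : ℂ) ≠ 0 := by
    simp [hl, Real.pi_ne_zero]
  rw [integral_exp_mul_complex hne, norm_div]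
  have h1 : ‖(2 * Real.pi * lam * Complex.I : ℂ)‖ = 2 * Real.pi * |lam| := by
    simp [abs_of_pos Real.pi_pos]
  have h2 (t : ℝ) : ‖Complex.exp (2 * Real.pi * lam * Complex.I * t)‖ = 1 := by
    rw [Complex.norm_exp]; simp
  have h3 := norm_sub_le (Complex.exp (2 * Real.pi * lam * Complex.I * (r : ℝ)))
    (Complex.exp (2 * Real.pi * lam * Complex.I * (0 : ℝ)))
  rw [h2, h2] at h3
  rw [h1]
  have : 0 < |lam| := abs_pos.2 hl
  rw [div_le_div_iff₀ (by positivity) this]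
  nlinarith [Real.pi_gt_three]

/-- If `p` is a nonzero integer polynomial with `p(0) = 0`, then `|p(n)| → ∞`. -/
theorem tendsto_abs_eval_atTop {p : Polynomial ℤ} (hp : p ≠ 0) (h0 : p.eval 0 = 0) :
    Tendsto (fun n : ℕ => |((p.eval (n : ℤ) : ℤ) : ℝ)|) atTop atTop := by
  have hdeg : 0 < (p.map (Int.castRingHom ℝ)).degree := by
    rw [Polynomial.degree_map_eq_of_injective (RingHom.injective_int _)]
    by_contra hcon
    have := Polynomial.eq_C_of_degree_le_zero (not_lt.1 hcon)
    rw [this] at h0 hp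
    simp at h0
    simp [h0] at hp
  have := (Polynomial.abs_tendsto_atTop _ hdeg).comp tendsto_natCast_atTop_atTop
  refine this.congr fun n => ?_
  simp only [Function.comp]
  rw [← Int.cast_natCast, Polynomial.eval_intCast_map]
  simp

open UnitAddTorus in
/-- Simultaneous approximation: if the integer polynomials `p i` vanish at `0` and satisfy no
integer linear relation, then for large `n` every target in the torus is approximated by the
multiples `p i (n) * δ` with an arbitrarily small rational `δ`. -/
theorem eventually_exists_approx {ι : Type*} [Fintype ι] {p : ι → Polynomial ℤ}
    (hp0 : ∀ i, (p i).eval 0 = 0) (hp : ∀ c : ι → ℤ, c ≠ 0 → ∑ i, c i • p i ≠ 0)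
    (u : ι → ℝ) {ε : ℝ} (hε : 0 < ε) :
    ∀ᶠ n : ℕ in atTop, ∃ δ : ℚ, 0 < δ ∧ (δ : ℝ) < ε ∧
      ∀ i, ∃ z : ℤ, |(((p i).eval (n : ℤ) : ℤ) : ℝ) * δ - u i - z| < ε := by
  let g : ℤ → ℝ → UnitAddTorus ι := fun n t i =>
    (((((p i).eval n : ℤ) : ℝ) * t : ℝ) : UnitAddCircle)
  have hg : ∀ n, Continuous (g n) := fun n =>
    continuous_pi fun i => (AddCircle.continuous_mk' 1).comp (by fun_prop)
  -- Weyl's criterion for the curve over `[0, ε]`: it suffices to test characters, and the integral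
  -- of the character `c` is at most `1 / |q(n)|` with `q = ∑ c i • p i`.
  let d : ℤ → C(UnitAddTorus ι, ℂ) → ℝ := fun n f =>
    ‖(∫ t in (0 : ℝ)..ε, f (g n t)) - ε * ∫ x, f x ∂torusMeasure ι‖
  have hint : ∀ n (f : C(UnitAddTorus ι, ℂ)),
      IntervalIntegrable (fun t => f (g n t)) volume 0 ε := fun n f =>
    (f.continuous.comp (hg n)).intervalIntegrable _ _
  have hint' : ∀ f : C(UnitAddTorus ι, ℂ), Integrable f (torusMeasure ι) := fun f =>
    f.continuous.integrable_of_hasCompactSupport (HasCompactSupport.of_compactSpace _)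
  have key : ∀ f : C(UnitAddTorus ι, ℂ),
      AvgZero (fun k => {(k : ℤ)}) fun n => d n f := by
    refine AvgZero.of_dense_span (2 * ε) (fun n x => norm_nonneg _) (fun n x y => ?_)
      (fun n c x => ?_) (fun n x => ?_) span_mFourier_closure_eq_top ?_
    · simp only [d, ContinuousMap.add_apply]
      rw [intervalIntegral.integral_add (hint n x) (hint n y), integral_add (hint' x) (hint' y)]
      refine le_trans (le_of_eq ?_) (norm_add_le _ _)
      congr 1; ring
    · simp only [d, ContinuousMap.smul_apply, smul_eq_mul]
      rw [intervalIntegral.integral_const_mul, integral_const_mul, ← norm_mul]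
      refine le_of_eq ?_
      congr 1; ring
    · have h1 : ‖∫ t in (0 : ℝ)..ε, x (g n t)‖ ≤ ‖x‖ * |ε - 0| :=
        intervalIntegral.norm_integral_le_of_norm_le_const fun t _ => x.norm_coe_le_norm _
      have h2 : ‖∫ y, x y ∂torusMeasure ι‖ ≤ ‖x‖ := by
        simpa using norm_integral_le_of_norm_le_const
          (μ := torusMeasure ι) (.of_forall fun y => x.norm_coe_le_norm y)
      rw [sub_zero, abs_of_pos hε] at h1
      calc d n x ≤ ‖∫ t in (0 : ℝ)..ε, x (g n t)‖ + ‖(ε : ℂ) * ∫ y, x y ∂torusMeasure ι‖ := norm_sub_le _ _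
        _ ≤ ‖x‖ * ε + ε * ‖x‖ := by
            rw [norm_mul, Complex.norm_real, Real.norm_eq_abs, abs_of_pos hε]; gcongr
        _ = _ := by ring
    · rintro _ ⟨c, rfl⟩
      rw [AvgZero.singleton_iff]
      rcases eq_or_ne c 0 with rfl | hc
      · simp [d, mFourier_zero]
      · have hq0 : (∑ i, c i • p i).eval 0 = 0 := by
          simp [Polynomial.eval_finsetSum, hp0]
        have hlim := tendsto_abs_eval_atTop (hp c hc) hq0
        refine squeeze_zero' (.of_forall fun _ => norm_nonneg _) ?_
          (hlim.inv_tendsto_atTop)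
        filter_upwards [hlim.eventually_gt_atTop 0] with n hn
        simp only [d, integral_mFourier hc, mul_zero, sub_zero, Pi.inv_apply]
        rw [← one_div]
        refine le_trans (le_of_eq ?_) (norm_integral_exp_le (r := ε) (abs_pos.1 hn))
        congr 1
        refine intervalIntegral.integral_congr fun t _ => ?_
        simp only [mFourier, ContinuousMap.coe_mk, g, fourier_coe_apply]
        rw [← Complex.exp_sum]
        congr 1
        simp only [Polynomial.eval_finsetSum, Finset.mul_sum, Finset.sum_mul, Int.cast_sum,
          Complex.ofReal_sum]
        push_cast
        refine Finset.sum_congr rfl fun i _ => ?_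
        simp
        ring
  let U : UnitAddTorus ι := fun i => (u i : UnitAddCircle)
  -- A bump supported in the `ε`-ball around the target. If the curve missed that ball, the defect
  -- would equal `ε * ∫ b`, against the strict bound `hn`.
  let b : UnitAddTorus ι → ℝ := fun x => max 0 (ε - ‖x - U‖)
  have hb : Continuous b := by fun_prop
  have hbpos : 0 < ∫ x, b x ∂torusMeasure ι :=
    hb.integral_pos_of_hasCompactSupport_nonneg_nonzero (x := U)
      (HasCompactSupport.of_compactSpace _) (fun x => le_max_left _ _) (by simp [b, hε])
  have hlim := AvgZero.singleton_iff.1 (key ⟨fun x => (b x : ℂ), by fun_prop⟩)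
  filter_upwards [(tendsto_order.1 hlim).2 (ε * ∫ x, b x ∂torusMeasure ι) (mul_pos hε hbpos)] with n hn
  have hex : ∃ t ∈ Set.Ioo 0 ε, ‖g n t - U‖ < ε := by
    by_contra! hcon
    have : ∫ t in (0 : ℝ)..ε, (b (g n t) : ℂ) = 0 := by
      rw [intervalIntegral.integral_of_le hε.le, integral_Ioc_eq_integral_Ioo]
      refine setIntegral_eq_zero_of_forall_eq_zero fun t ht => ?_
      simp [b, hcon t ht]
    simp only [d, ContinuousMap.coe_mk, this, zero_sub, norm_neg, integral_complex_ofReal] at hn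
    rw [norm_mul, Complex.norm_real, Complex.norm_real, Real.norm_eq_abs, Real.norm_eq_abs,
      abs_of_pos hε, abs_of_pos hbpos] at hn
    exact lt_irrefl _ hn
  -- The good times form a nonempty open set, hence contain a rational one.
  have hopen : IsOpen (Set.Ioo 0 ε ∩ {t | ‖g n t - U‖ < ε}) :=
    isOpen_Ioo.inter (isOpen_lt (by have := hg n; fun_prop) continuous_const)
  obtain ⟨δ, hδ⟩ := Rat.denseRange_cast.exists_mem_open hopen
    (by obtain ⟨t, h1, h2⟩ := hex; exact ⟨t, h1, h2⟩)
  refine ⟨δ, by exact_mod_cast hδ.1.1, hδ.1.2, fun i => ?_⟩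
  have h1 : ‖(((((p i).eval (n : ℤ) : ℤ) : ℝ) * δ - u i : ℝ) : UnitAddCircle)‖ < ε :=
    (norm_le_pi_norm (g n δ - U) i).trans_lt hδ.2
  rw [AddCircle.norm_eq] at h1
  exact ⟨_, by simpa using h1⟩

/-! ### Choice of the subsequence and of the rationals `δ`. -/

theorem eval_dvd_of_eval_zero {p : Polynomial ℤ} (h0 : p.eval 0 = 0) (n : ℤ) : n ∣ p.eval n := by
  simpa [h0] using Polynomial.sub_dvd_eval_sub n 0 p

/-- A common sequence `r` and, for each pattern `ξ`, rational numbers `δ k` such that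
`p i (m (r k)) * δ l` is an integer for `l < k`, close to `ξ i / 2` modulo `1` for `l = k` and
small for `l > k`. -/
theorem exists_subsequence_approx {ι : Type*} [Fintype ι] {p : ι → Polynomial ℤ}
    (hp0 : ∀ i, (p i).eval 0 = 0) (hp : ∀ c : ι → ℤ, c ≠ 0 → ∑ i, c i • p i ≠ 0)
    {m : ℕ → ℕ} (hm_mono : StrictMonoOn m (Set.Ici 1)) (hm_dvd : ∀ k, 1 ≤ k → k ! ∣ m k) :
    ∃ r : ℕ → ℕ, StrictMono r ∧ (∀ k, 1 ≤ r k) ∧ ∀ ξ : ι → Bool, ∃ δ : ℕ → ℝ,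
      (∀ k, |δ k| ≤ (1 / 2) ^ k) ∧
      (∀ i k l, l < k → ∃ z : ℤ, (((p i).eval (m (r k) : ℤ) : ℤ) : ℝ) * δ l = z) ∧
      (∀ i k, ∃ z : ℤ, |(((p i).eval (m (r k) : ℤ) : ℤ) : ℝ) * δ k -
        (if ξ i then 1 / 2 else 0) - z| ≤ (1 / 2) ^ k) ∧
      (∀ i k l, k < l → |(((p i).eval (m (r k) : ℤ) : ℤ) : ℝ) * δ l| ≤ (1 / 2) ^ l) := by
  classical
  have hm_top : Tendsto m atTop atTop := by
    -- The value `m 0` is unconstrained, so monotonicity is read from index `1` on.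
    have h : StrictMono fun k => m (k + 1) := fun a b hab =>
      hm_mono (Set.mem_Ici.2 (by omega)) (Set.mem_Ici.2 (by omega)) (by omega)
    exact (tendsto_add_atTop_iff_nat 1).1 h.tendsto_atTop
  have step : ∀ K : ℕ, ∃ r : ℕ, K < r ∧ ∃ δ : (ι → Bool) → ℚ, ∀ ξ, 0 < δ ξ ∧
      (δ ξ : ℝ) < 1 / (K + 1) ∧ ∀ i, ∃ z : ℤ, |(((p i).eval (m r : ℤ) : ℤ) : ℝ) * δ ξ -
        (if ξ i then 1 / 2 else 0) - z| < 1 / (K + 1) := by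
    intro K
    -- Finitely many patterns, so a single index works for all of them.
    have h1 := eventually_all.2 fun ξ : ι → Bool =>
      eventually_exists_approx hp0 hp (fun i => if ξ i then 1 / 2 else 0)
        (ε := 1 / ((K : ℝ) + 1)) (by positivity)
    obtain ⟨r, hr, hrK⟩ := ((hm_top.eventually h1).and (eventually_gt_atTop K)).exists
    choose δ hδ using hr
    exact ⟨r, hrK, δ, hδ⟩
  choose R hR D hD hDlt hDi using step
  -- One bound for everything chosen at stage `K`: the index, all denominators, all polynomial
  -- values.
  let b : ℕ → ℕ := fun K => R K + ∑ ξ, (D K ξ).den + ∑ i, ((p i).eval (m (R K) : ℤ)).natAbs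
  have hbR : ∀ K, R K ≤ b K := fun K => by simp only [b]; omega
  have hbD : ∀ K ξ, (D K ξ).den ≤ b K := fun K ξ => by
    have := Finset.single_le_sum (f := fun ξ => (D K ξ).den) (fun _ _ => Nat.zero_le _)
      (Finset.mem_univ ξ)
    simp only [b]; omega
  have hbp : ∀ K i, ((p i).eval (m (R K) : ℤ)).natAbs ≤ b K := fun K i => by
    have := Finset.single_le_sum (f := fun i => ((p i).eval (m (R K) : ℤ)).natAbs)
      (fun _ _ => Nat.zero_le _) (Finset.mem_univ i)
    simp only [b]; omega
  -- The stages grow so fast that `κ l` dominates all data of earlier stages, even multiplied by `2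
  -- ^ l`; the tolerance at stage `l` is `1 / (κ l + 1)`.
  obtain ⟨κ, hκ0, hκ⟩ : ∃ κ : ℕ → ℕ, κ 0 = 1 ∧
      ∀ l, κ (l + 1) = 2 ^ (l + 1) * (b (κ l) + κ l + 1) :=
    ⟨fun l => Nat.rec 1 (fun l K => 2 ^ (l + 1) * (b K + K + 1)) l, rfl, fun l => rfl⟩
  have hκ1 : ∀ l, b (κ l) + κ l + 1 ≤ κ (l + 1) := fun l => by
    rw [hκ]; exact Nat.le_mul_of_pos_left _ (by positivity)
  have hκpow : ∀ l, 2 ^ l ≤ κ l := by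
    intro l
    cases l with
    | zero => simp [hκ0]
    | succ l => rw [hκ]; exact Nat.le_mul_of_pos_right _ (by omega)
  have hbκ : ∀ k l, k < l → b (κ k) ≤ κ l := by
    intro k l hkl
    induction l, hkl using Nat.le_induction with
    | base => have := hκ1 k; rw [Nat.succ_eq_add_one]; omega
    | succ l _ ih => have := hκ1 l; omega
  have hbκ' : ∀ k l, k < l → 2 ^ l * b (κ k) ≤ κ l := by
    intro k l hkl
    obtain ⟨l, rfl⟩ : ∃ l', l = l' + 1 := ⟨l - 1, by omega⟩
    rw [hκ]
    refine Nat.mul_le_mul_left _ ?_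
    rcases (Nat.lt_succ_iff.1 hkl).eq_or_lt with rfl | h
    · omega
    · have := hbκ k l h; omega
  have hinv : ∀ l, 1 / ((κ l : ℝ) + 1) ≤ (1 / 2) ^ l := by
    intro l
    rw [one_div_pow]
    have : ((2 : ℝ) ^ l) ≤ κ l := by exact_mod_cast hκpow l
    gcongr
    linarith
  refine ⟨fun k => R (κ k), strictMono_nat_of_lt_succ fun k => ?_, fun k => ?_,
    fun ξ => ⟨fun l => D (κ l) ξ, fun k => ?_, fun i k l hlk => ?_, fun i k => ?_,
      fun i k l hkl => ?_⟩⟩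
  · have := hκ1 k; have := hbR (κ k); have := hR (κ (k + 1)); omega
  · exact Nat.one_le_of_lt (hR (κ k))
  · rw [abs_of_pos (show (0 : ℝ) < (D (κ k) ξ : ℝ) by exact_mod_cast hD _ _)]
    exact (hDlt _ _).le.trans (hinv k)
  -- The denominator is at most `κ k < R (κ k)`, so it divides the factorial of `R (κ k)`, hence `m
  -- (R (κ k))`, hence the value of `p i` there.
  · have h1 : (D (κ l) ξ).den ∣ m (R (κ k)) := by
      refine (Nat.dvd_factorial (Rat.den_pos _) ?_).trans (hm_dvd _ (by have := hR (κ k); omega))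
      exact ((hbD _ _).trans (hbκ l k hlk)).trans (hR _).le
    obtain ⟨c, hc⟩ := (Int.natCast_dvd_natCast.2 h1).trans (eval_dvd_of_eval_zero (hp0 i) _)
    refine ⟨c * (D (κ l) ξ).num, ?_⟩
    rw [hc]
    have h2 : ((D (κ l) ξ).den : ℝ) * (D (κ l) ξ : ℝ) = (D (κ l) ξ).num := by
      exact_mod_cast Rat.den_mul_eq_num _
    push_cast
    linear_combination (c : ℝ) * h2
  · obtain ⟨z, hz⟩ := hDi (κ k) ξ i
    exact ⟨z, hz.le.trans (hinv k)⟩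
  · have h1 : |(((p i).eval (m (R (κ k)) : ℤ) : ℤ) : ℝ)| ≤ b (κ k) := by
      rw [← Int.cast_abs, Int.abs_eq_natAbs]; exact_mod_cast hbp (κ k) i
    have h2 : (2 : ℝ) ^ l * b (κ k) ≤ κ l := by exact_mod_cast hbκ' k l hkl
    rw [abs_mul, abs_of_pos (show (0 : ℝ) < (D (κ l) ξ : ℝ) by exact_mod_cast hD _ _)]
    calc _ ≤ (b (κ k) : ℝ) * (1 / (κ l + 1)) := by
          have := (hDlt (κ l) ξ).le
          have : (0 : ℝ) ≤ D (κ l) ξ := by exact_mod_cast (hD (κ l) ξ).le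
          gcongr
      _ ≤ _ := by
          rw [one_div_pow, mul_one_div, div_le_div_iff₀ (by positivity) (by positivity)]
          linarith

/-! ### Infinite cosine products. -/

/-- The function `t ↦ (1 + cos 2πt) / 2`. -/
def cosFactor (t : ℝ) : ℝ := (1 + Real.cos (2 * Real.pi * t)) / 2

theorem cosFactor_nonneg (t : ℝ) : 0 ≤ cosFactor t := by
  have := Real.neg_one_le_cos (2 * Real.pi * t); unfold cosFactor; linarith

theorem cosFactor_le_one (t : ℝ) : cosFactor t ≤ 1 := by
  have := Real.cos_le_one (2 * Real.pi * t); unfold cosFactor; linarith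

theorem cosFactor_neg (t : ℝ) : cosFactor (-t) = cosFactor t := by
  simp [cosFactor]

theorem cosFactor_add_int (t : ℝ) (z : ℤ) : cosFactor (t + z) = cosFactor t := by
  unfold cosFactor
  rw [show 2 * Real.pi * (t + z) = 2 * Real.pi * t + z * (2 * Real.pi) by ring,
    Real.cos_add_int_mul_two_pi]

theorem cosFactor_add_half (t : ℝ) : cosFactor (t + 1 / 2) = 1 - cosFactor t := by
  unfold cosFactor
  rw [show 2 * Real.pi * (t + 1 / 2) = 2 * Real.pi * t + Real.pi by ring, Real.cos_add_pi]
  ring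

theorem abs_cosFactor_sub_le (s t : ℝ) : |cosFactor s - cosFactor t| ≤ 4 * |s - t| := by
  have h : |Real.cos (2 * Real.pi * s) - Real.cos (2 * Real.pi * t)| ≤
      |2 * Real.pi * s - 2 * Real.pi * t| := by
    simpa [Real.dist_eq] using Real.lipschitzWith_cos.dist_le_mul (2 * Real.pi * s)
      (2 * Real.pi * t)
  rw [← mul_sub, abs_mul, abs_of_pos (show (0 : ℝ) < 2 * Real.pi by positivity)] at h
  have h2 : cosFactor s - cosFactor t =
      (Real.cos (2 * Real.pi * s) - Real.cos (2 * Real.pi * t)) / 2 := by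
    unfold cosFactor; ring
  rw [h2, abs_div, abs_two]
  -- The Lipschitz constant is `π`; `4` is a convenient upper bound.
  nlinarith [Real.pi_lt_four, abs_nonneg (s - t)]

/-- Factors are exchanged one at a time; since all lie in `[0, 1]`, each exchange costs at most the
change in that factor. -/
theorem abs_prod_sub_prod_le {x y : ℕ → ℝ} (hx0 : ∀ l, 0 ≤ x l) (hx1 : ∀ l, x l ≤ 1)
    (hy0 : ∀ l, 0 ≤ y l) (hy1 : ∀ l, y l ≤ 1) (L : ℕ) :
    |∏ l ∈ Finset.range L, x l - ∏ l ∈ Finset.range L, y l| ≤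
      ∑ l ∈ Finset.range L, |x l - y l| := by
  induction L with
  | zero => simp
  | succ L ih =>
    rw [Finset.prod_range_succ, Finset.prod_range_succ, Finset.sum_range_succ]
    have h1 : |∏ l ∈ Finset.range L, y l| ≤ 1 := by
      rw [abs_of_nonneg (Finset.prod_nonneg fun l _ => hy0 l)]
      exact Finset.prod_le_one (fun l _ => hy0 l) fun l _ => hy1 l
    have h2 : |x L| ≤ 1 := by rw [abs_of_nonneg (hx0 L)]; exact hx1 L
    set X := ∏ l ∈ Finset.range L, x l
    set Y := ∏ l ∈ Finset.range L, y l
    calc |X * x L - Y * y L| = |(X - Y) * x L + Y * (x L - y L)| := by congr 1; ring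
      _ ≤ |X - Y| * |x L| + |Y| * |x L - y L| := by
          rw [← abs_mul, ← abs_mul]; exact abs_add_le _ _
      _ ≤ |X - Y| * 1 + 1 * |x L - y L| := by gcongr
      _ ≤ _ := by linarith

/-- The limit of the infinite cosine products along a sequence `s k` adapted to `δ`. -/
theorem tendsto_cosProduct {δ : ℕ → ℝ} {c : ℤ → ℝ}
    (hc : ∀ n : ℤ, Tendsto (fun L => ∏ l ∈ Finset.range L, cosFactor (n * δ l)) atTop (𝓝 (c n)))
    (hδ : ∀ k, |δ k| ≤ (1 / 2) ^ k) {s : ℕ → ℤ} {b : Bool}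
    (h1 : ∀ k l, l < k → ∃ z : ℤ, (s k : ℝ) * δ l = z)
    (h2 : ∀ k, ∃ z : ℤ, |(s k : ℝ) * δ k - (if b then 1 / 2 else 0) - z| ≤ (1 / 2) ^ k)
    (h3 : ∀ k l, k < l → |(s k : ℝ) * δ l| ≤ (1 / 2) ^ l) (a : ℤ) :
    Tendsto (fun k => c (s k + a)) atTop (𝓝 ((if b then 0 else 1) * c a)) := by
  classical
  let β : ℝ := if b then 0 else 1
  have hβ0 : 0 ≤ β := by simp only [β]; split_ifs <;> norm_num
  have hβ1 : β ≤ 1 := by simp only [β]; split_ifs <;> norm_num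
  have hbound : ∀ k, |c (s k + a) - β * c a| ≤ (4 + 4 * |(a : ℝ)|) * (1 / 2) ^ k
      + 4 * (1 / 2) ^ k := by
    intro k
    let x : ℕ → ℝ := fun l => cosFactor (((s k + a : ℤ) : ℝ) * δ l)
    -- The comparison product is the one for `a`, with the factor `k` alone multiplied by `β`, so
    -- its limit is `β * c a`.
    let y : ℕ → ℝ := fun l => (if l = k then β else 1) * cosFactor (a * δ l)
    have hprod : ∀ L, k < L → ∏ l ∈ Finset.range L, y l =
        β * ∏ l ∈ Finset.range L, cosFactor (a * δ l) := by
      intro L hL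
      simp only [y]
      rw [Finset.prod_mul_distrib, Finset.prod_ite_eq' (Finset.range L) k]
      simp [hL]
    have hx : Tendsto (fun L => ∏ l ∈ Finset.range L, x l) atTop (𝓝 (c (s k + a))) := hc _
    have hy : Tendsto (fun L => ∏ l ∈ Finset.range L, y l) atTop (𝓝 (β * c a)) := by
      refine ((hc a).const_mul β).congr' ?_
      filter_upwards [eventually_gt_atTop k] with L hL
      exact (hprod L hL).symm
    have hk : |x k - y k| ≤ (4 + 4 * |(a : ℝ)|) * (1 / 2) ^ k := by
      obtain ⟨z, hz⟩ := h2 k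
      have e1 : x k - y k = (cosFactor ((s k + a : ℤ) * δ k) -
          cosFactor ((if b then 1 / 2 else 0) + a * δ k + z)) +
          (cosFactor (a * δ k + (if b then 1 / 2 else 0)) - β * cosFactor (a * δ k)) := by
        simp only [x, y, if_true, cosFactor_add_int]
        rw [add_comm (a * δ k)]; ring
      have e2 := abs_cosFactor_sub_le ((s k + a : ℤ) * δ k)
        ((if b then 1 / 2 else 0) + a * δ k + z)
      have e3 : ((s k + a : ℤ) : ℝ) * δ k - ((if b then 1 / 2 else 0) + a * δ k + z) =
          (s k : ℝ) * δ k - (if b then 1 / 2 else 0) - z := by push_cast; ring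
      rw [e3] at e2
      have e4 : |cosFactor (a * δ k + (if b then 1 / 2 else 0)) - β * cosFactor (a * δ k)| ≤
          4 * |(a : ℝ)| * (1 / 2) ^ k := by
        cases b with
        | false => simp [β]
        | true =>
          -- The half shift turns the factor into `1 - cosFactor (a * δ k)`, which is small because
          -- `δ k` is.
          simp only [β, if_true, cosFactor_add_half]
          have e5 := abs_cosFactor_sub_le 0 (a * δ k)
          have e6 : cosFactor 0 = 1 := by simp [cosFactor]
          rw [e6, zero_sub, abs_neg, abs_mul] at e5
          simp only [zero_mul, sub_zero]
          calc _ ≤ _ := e5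
            _ ≤ 4 * (|(a : ℝ)| * (1 / 2) ^ k) := by gcongr; exact hδ k
            _ = _ := by ring
      rw [e1]
      refine (abs_add_le _ _).trans ?_
      linarith
    have hl : ∀ l, |x l - y l| ≤ (if l = k then (4 + 4 * |(a : ℝ)|) * (1 / 2) ^ k else 0) +
        (if k < l then 4 * (1 / 2) ^ l else 0) := by
      intro l
      rcases lt_trichotomy l k with h | rfl | h
      · obtain ⟨z, hz⟩ := h1 k l h
        have : x l = y l := by
          simp only [x, y, if_neg h.ne, one_mul]
          rw [← cosFactor_add_int (a * δ l) z, ← hz]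
          congr 1; push_cast; ring
        simp [this, h.ne, h.not_gt]
      · simpa using hk
      · simp only [x, y, if_neg h.ne', one_mul, if_pos h, zero_add]
        refine (abs_cosFactor_sub_le _ _).trans ?_
        rw [show ((s k + a : ℤ) : ℝ) * δ l - a * δ l = s k * δ l by push_cast; ring]
        linarith [h3 k l h]
    have hsum : ∀ L, ∑ l ∈ Finset.range L, (if k < l then 4 * (1 / 2 : ℝ) ^ l else 0) ≤
        4 * (1 / 2) ^ k := by
      intro L
      -- The exact geometric partial sum makes the induction close; `L - 1` only occurs when `k <
      -- L`.
      have : ∀ L, ∑ l ∈ Finset.range L, (if k < l then 4 * (1 / 2 : ℝ) ^ l else 0) ≤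
          if k < L then 4 * (1 / 2) ^ k - 4 * (1 / 2) ^ (L - 1) else 0 := by
        intro L
        induction L with
        | zero => simp
        | succ L ih =>
          rw [Finset.sum_range_succ]
          rcases lt_trichotomy k L with h | rfl | h
          · rw [if_pos h] at ih ⊢
            rw [if_pos (by omega)]
            obtain ⟨L, rfl⟩ : ∃ L', L = L' + 1 := ⟨L - 1, by omega⟩
            simp only [Nat.add_sub_cancel] at ih ⊢
            rw [pow_succ] at *
            linarith
          · simpa using ih
          · rw [if_neg h.not_gt] at ih ⊢
            rw [if_neg (by omega)]
            linarith
      refine (this L).trans ?_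
      split_ifs
      · have : (0 : ℝ) ≤ 4 * (1 / 2) ^ (L - 1) := by positivity
        linarith
      · positivity
    refine le_of_tendsto (hx.sub hy).abs (.of_forall fun L => ?_)
    refine (abs_prod_sub_prod_le (fun l => cosFactor_nonneg _) (fun l => cosFactor_le_one _)
      (fun l => ?_) (fun l => ?_) L).trans ?_
    · exact mul_nonneg (by split_ifs <;> simp [hβ0]) (cosFactor_nonneg _)
    · exact mul_le_one₀ (by split_ifs <;> simp [hβ1]) (cosFactor_nonneg _) (cosFactor_le_one _)
    · refine (Finset.sum_le_sum fun l _ => hl l).trans ?_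
      rw [Finset.sum_add_distrib]
      refine add_le_add ?_ (hsum L)
      rw [Finset.sum_ite_eq']
      split_ifs
      · exact le_rfl
      · positivity
  rw [← tendsto_sub_nhds_zero_iff]
  refine squeeze_zero_norm hbound ?_
  have hp : Tendsto (fun k : ℕ => (1 / 2 : ℝ) ^ k) atTop (𝓝 0) :=
    tendsto_pow_atTop_nhds_zero_of_lt_one (by norm_num) (by norm_num)
  simpa using (hp.const_mul (4 + 4 * |(a : ℝ)|)).add (hp.const_mul 4)

/-! ### Cesàro averages of Fourier coefficients and the atom at `0`. -/

theorem fourier_natCast_eq_pow (n : ℕ) (x : UnitAddCircle) :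
    fourier (n : ℤ) x = (fourier 1 x) ^ n := by
  simp [fourier_apply, AddCircle.toCircle_nsmul]

theorem norm_fourier_apply (n : ℤ) (x : UnitAddCircle) : ‖(fourier n x : ℂ)‖ = 1 :=
  Circle.norm_coe _

theorem tendsto_average_pow {z : ℂ} (hz : ‖z‖ ≤ 1) (hz1 : z ≠ 1) :
    Tendsto (fun M : ℕ => (M : ℂ)⁻¹ * ∑ n ∈ Finset.Icc 1 M, z ^ n) atTop (𝓝 0) := by
  have hlim : Tendsto (fun M : ℕ => (M : ℝ)⁻¹ * (2 / ‖z - 1‖)) atTop (𝓝 0) := by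
    simpa using (tendsto_inv_atTop_zero.comp tendsto_natCast_atTop_atTop).mul_const (2 / ‖z - 1‖)
  refine squeeze_zero_norm (fun M => ?_) hlim
  have h1 : ∑ n ∈ Finset.Icc 1 M, z ^ n = z * ((z ^ M - 1) / (z - 1)) := by
    rw [← geom_sum_eq hz1, Finset.mul_sum, Finset.range_eq_Ico]
    simp only [← pow_succ']
    rw [Finset.sum_Ico_add' (fun n => z ^ n) 0 M 1]
    rfl
  have h2 : ‖z ^ M - 1‖ ≤ 2 := by
    refine (norm_sub_le _ _).trans ?_
    have := pow_le_one₀ (n := M) (norm_nonneg z) hz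
    rw [norm_pow, norm_one]; linarith
  have h3 : 0 < ‖z - 1‖ := norm_pos_iff.2 (sub_ne_zero.2 hz1)
  rw [h1, norm_mul, norm_inv, Complex.norm_natCast, norm_mul, norm_div]
  gcongr
  calc ‖z‖ * (‖z ^ M - 1‖ / ‖z - 1‖) ≤ 1 * (2 / ‖z - 1‖) := by gcongr
    _ = _ := one_mul _

/-- If the Fourier coefficients of a finite measure tend to zero along all translates of some
sequence, then they average to zero. -/
theorem tendsto_average_fourierCoeff {ρ : Measure UnitAddCircle} [IsFiniteMeasure ρ] {s : ℕ → ℤ}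
    (h : ∀ a, Tendsto (fun k => ∫ x, fourier (s k + a) x ∂ρ) atTop (𝓝 0)) (a : ℤ) :
    Tendsto (fun M : ℕ => (M : ℂ)⁻¹ * ∑ n ∈ Finset.Icc 1 M, ∫ x, fourier (n + a) x ∂ρ)
      atTop (𝓝 0) := by
  let D : ℕ → UnitAddCircle → ℂ := fun M x => (M : ℂ)⁻¹ * ∑ n ∈ Finset.Icc 1 M, fourier (n : ℤ) x
  -- The averages `D M` of characters converge boundedly to the indicator of `{0}`, so the averaged
  -- coefficients converge to the mass of the atom at `0`.
  let χ : UnitAddCircle → ℂ := Set.indicator {0} 1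
  have hχm : Measurable χ := measurable_one.indicator (measurableSet_singleton 0)
  have hDc : ∀ M, Continuous (D M) := fun M => by fun_prop
  have hD1 : ∀ M x, ‖D M x‖ ≤ 1 := by
    intro M x
    calc ‖D M x‖ ≤ (M : ℝ)⁻¹ * ∑ n ∈ Finset.Icc 1 M, (1 : ℝ) := by
          rw [norm_mul, norm_inv, Complex.norm_natCast]
          gcongr
          exact (norm_sum_le _ _).trans (Finset.sum_le_sum fun n _ => (norm_fourier_apply _ _).le)
      _ ≤ 1 := by simp [inv_mul_le_one]
  have hχ1 : ∀ x, ‖χ x‖ ≤ 1 := fun x => by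
    simp only [χ, Set.indicator]; split_ifs <;> simp
  have hDχ : ∀ x, Tendsto (fun M => D M x) atTop (𝓝 (χ x)) := by
    intro x
    by_cases hx : x = 0
    · subst hx
      refine tendsto_const_nhds.congr' ?_
      filter_upwards [eventually_gt_atTop 0] with M hM
      simp [D, χ, hM.ne']
    · have hz1 : (fourier 1 x : ℂ) ≠ 1 := by
        intro hz
        apply hx
        apply AddCircle.injective_toCircle (one_ne_zero)
        ext
        simpa [fourier_apply] using hz
      have := tendsto_average_pow (z := fourier 1 x) (norm_fourier_apply _ _).le hz1
      simpa [D, χ, hx, fourier_natCast_eq_pow, -fourier_apply] using this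
  have hint : ∀ {f : UnitAddCircle → ℂ}, Measurable f → (∃ C, ∀ x, ‖f x‖ ≤ C) → Integrable f ρ :=
    fun hf ⟨C, hC⟩ => Integrable.of_bound hf.aestronglyMeasurable C (.of_forall hC)
  have hη : Tendsto (fun M => ∫ x, ‖D M x - χ x‖ ∂ρ) atTop (𝓝 0) := by
    have := tendsto_integral_of_dominated_convergence (μ := ρ) (F := fun M x => ‖D M x - χ x‖)
      (f := fun _ => 0) (fun _ => (2 : ℝ))
      (fun M => ((hDc M).measurable.sub hχm).norm.aestronglyMeasurable)
      (integrable_const _)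
      (fun M => .of_forall fun x => by
        have := norm_sub_le (D M x) (χ x)
        rw [norm_norm]
        linarith [hD1 M x, hχ1 x])
      (.of_forall fun x => by
        simpa using ((hDχ x).sub_const (χ x)).norm)
    simpa using this
  have hmulD : ∀ (b : ℤ) M, ∫ x, fourier b x * D M x ∂ρ =
      (M : ℂ)⁻¹ * ∑ n ∈ Finset.Icc 1 M, ∫ x, fourier (b + n) x ∂ρ := by
    intro b M
    rw [← integral_finsetSum, ← integral_const_mul]
    · refine integral_congr_ae (.of_forall fun x => ?_)
      simp only [D, Finset.mul_sum, fourier_add]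
      refine Finset.sum_congr rfl fun n _ => by ring
    · exact fun n _ => hint (map_continuous _).measurable ⟨1, fun x => (norm_fourier_apply _ _).le⟩
  -- The bound is uniform in the frequency `b`.
  have hdiff : ∀ (b : ℤ) M, ‖∫ x, fourier b x * D M x ∂ρ - ∫ x, fourier b x * χ x ∂ρ‖ ≤
      ∫ x, ‖D M x - χ x‖ ∂ρ := by
    intro b M
    rw [← integral_sub]
    · refine (norm_integral_le_integral_norm _).trans (le_of_eq ?_)
      refine integral_congr_ae (.of_forall fun x => ?_)
      simp [← mul_sub, norm_fourier_apply, -fourier_apply]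
    · refine hint (by have := (hDc M).measurable; fun_prop) ⟨1, fun x => ?_⟩
      simpa [norm_fourier_apply, -fourier_apply] using hD1 M x
    · refine hint (by fun_prop) ⟨1, fun x => ?_⟩
      simpa [norm_fourier_apply, -fourier_apply] using hχ1 x
  have hχint : ∀ b : ℤ, ∫ x, fourier b x * χ x ∂ρ = ρ.real {0} := by
    intro b
    have : ∀ x, fourier b x * χ x = Set.indicator {0} (fun _ => (1 : ℂ)) x := by
      intro x
      by_cases hx : x = 0
      · subst hx; simp [χ]
      · simp [χ, hx]
    rw [integral_congr_ae (.of_forall this), integral_indicator (measurableSet_singleton _)]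
    simp [Measure.real]
  -- With `M` fixed, let the frequency run along `s k`: the averaged coefficients tend to `0` yet
  -- stay within the error of `ρ {0}`. Then let `M → ∞`.
  have hatom : ρ.real {0} = 0 := by
    have hle : ∀ M, ρ.real {0} ≤ ∫ x, ‖D M x - χ x‖ ∂ρ := by
      intro M
      have h1 : Tendsto (fun k => ∫ x, fourier (s k) x * D M x ∂ρ) atTop (𝓝 0) := by
        simp only [hmulD]
        simpa using (tendsto_finsetSum (Finset.Icc 1 M) fun n _ => h n).const_mul (M : ℂ)⁻¹
      have h2 := (h1.sub_const (ρ.real {0} : ℂ)).norm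
      rw [zero_sub, norm_neg, Complex.norm_real, Real.norm_of_nonneg measureReal_nonneg] at h2
      refine le_of_tendsto h2 (.of_forall fun k => ?_)
      rw [← hχint (s k)]
      exact hdiff _ _
    exact le_antisymm (ge_of_tendsto' hη hle) measureReal_nonneg
  refine squeeze_zero_norm (fun M => ?_) hη
  have h1 := hdiff a M
  rw [hχint, hatom, Complex.ofReal_zero, sub_zero, hmulD] at h1
  simpa only [add_comm a] using h1

/-! ### The spectral measure as the law of a random series. -/

/-- The four equally likely values of the coefficients in the random series. -/
def coin : Fin 4 → ℝ := ![0, 0, 1, -1]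

theorem abs_coin_le (i : Fin 4) : |coin i| ≤ 1 := by
  fin_cases i <;> simp [coin]

/-- The uniform measure on four points. -/
abbrev coinMeasure : Measure (Fin 4) := (PMF.uniformOfFintype (Fin 4)).toMeasure

/-- The doubled value `0` makes the transform nonnegative and zero at `1/2`; a fair sign would give
`cos 2πt`, which is `-1` there. -/
theorem integral_exp_coin (t : ℝ) :
    ∫ i, Complex.exp (2 * Real.pi * Complex.I * (t * coin i : ℝ)) ∂coinMeasure = cosFactor t := by
  rw [PMF.integral_eq_sum, Fin.sum_univ_four]
  have h : (Real.cos (2 * Real.pi * t) : ℂ) = (Complex.exp (2 * Real.pi * Complex.I * t) +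
      Complex.exp (-(2 * Real.pi * Complex.I * t))) / 2 := by
    rw [Complex.ofReal_cos, Complex.cos]
    push_cast
    ring_nf
  simp [coin, cosFactor, PMF.uniformOfFintype_apply] at h ⊢
  rw [h]; ring

/-- The law of the random series `∑ ε l * δ l` on the circle, with independent coefficients
`ε l`, has infinite cosine products as Fourier coefficients. -/
theorem exists_measure_cosProduct {δ : ℕ → ℝ} (hδ : ∀ k, |δ k| ≤ (1 / 2) ^ k) :
    ∃ (ρ : Measure UnitAddCircle) (c : ℤ → ℝ), IsProbabilityMeasure ρ ∧
      (∀ n, ∫ x, fourier n x ∂ρ = c n) ∧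
      ∀ n : ℤ, Tendsto (fun L => ∏ l ∈ Finset.range L, cosFactor (n * δ l)) atTop (𝓝 (c n)) := by
  let P : Measure (ℕ → Fin 4) := Measure.infinitePi fun _ => coinMeasure
  let S : ℕ → (ℕ → Fin 4) → ℝ := fun L ω => ∑ l ∈ Finset.range L, δ l * coin (ω l)
  let X : (ℕ → Fin 4) → ℝ := fun ω => ∑' l, δ l * coin (ω l)
  have hcoin : Measurable coin := measurable_of_finite _
  have hS : ∀ L, Measurable (S L) := fun L =>
    Finset.measurable_sum _ fun l _ => (hcoin.comp (measurable_pi_apply l)).const_mul _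
  have hSX : ∀ ω, Tendsto (fun L => S L ω) atTop (𝓝 (X ω)) := fun ω => by
    refine (Summable.of_norm_bounded (summable_geometric_two) fun l => ?_).hasSum.tendsto_sum_nat
    rw [Real.norm_eq_abs, abs_mul]
    calc _ ≤ (1 / 2 : ℝ) ^ l * 1 := by gcongr; exacts [hδ l, abs_coin_le _]
      _ = _ := mul_one _
  have hX : Measurable X := measurable_of_tendsto_metrizable hS (tendsto_pi_nhds.2 hSX)
  have hXc : Measurable fun ω => (X ω : UnitAddCircle) :=
    (AddCircle.continuous_mk' 1).measurable.comp hX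
  let e : ℤ → ℝ → ℂ := fun n t => fourier n (t : UnitAddCircle)
  have he : ∀ n, Continuous (e n) := fun n =>
    (map_continuous (fourier n)).comp (AddCircle.continuous_mk' 1)
  have hprod : ∀ (n : ℤ) L, ∫ ω, e n (S L ω) ∂P =
      ((∏ l ∈ Finset.range L, cosFactor (n * δ l) : ℝ) : ℂ) := by
    intro n L
    have hind : iIndepFun (fun (l : Fin L) (ω : ℕ → Fin 4) =>
        Complex.exp (2 * Real.pi * Complex.I * ((n * δ l) * coin (ω l) : ℝ))) P := by
      have := iIndepFun_infinitePi (P := fun _ : ℕ => coinMeasure)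
        (X := fun l i => Complex.exp (2 * Real.pi * Complex.I * ((n * δ l) * coin i : ℝ)))
        (fun l => measurable_of_finite _)
      exact this.precomp Fin.val_injective
    have h1 := hind.integral_fun_prod_eq_prod_integral fun l => by
      refine Measurable.aestronglyMeasurable ?_
      exact (measurable_of_finite (fun i => Complex.exp (2 * Real.pi * Complex.I *
        ((n * δ l) * coin i : ℝ)))).comp (measurable_pi_apply _)
    rw [Finset.prod_range, Complex.ofReal_prod]
    convert h1 using 1
    · refine integral_congr_ae (.of_forall fun ω => ?_)
      simp only [e, fourier_coe_apply, S]
      rw [← Complex.exp_sum, Finset.sum_range]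
      congr 1
      simp only [← Finset.mul_sum, ← Complex.ofReal_sum, mul_assoc]
      push_cast
      ring
    · refine Finset.prod_congr rfl fun l _ => ?_
      rw [← integral_exp_coin]
      rw [← (measurePreserving_eval_infinitePi (fun _ => coinMeasure) (l : ℕ)).map_eq,
        integral_map (measurable_pi_apply _).aemeasurable
          (measurable_of_finite _).aestronglyMeasurable]
  have hlim : ∀ n, Tendsto (fun L => ∫ ω, e n (S L ω) ∂P) atTop (𝓝 (∫ ω, e n (X ω) ∂P)) := by
    intro n
    refine tendsto_integral_of_dominated_convergence (fun _ => (1 : ℝ))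
      (fun L => ((he n).measurable.comp (hS L)).aestronglyMeasurable) (integrable_const _)
      (fun L => .of_forall fun ω => (norm_fourier_apply _ _).le)
      (.of_forall fun ω => ((he n).tendsto _).comp (hSX ω))
  have hlim' : ∀ n : ℤ, Tendsto (fun L => ∏ l ∈ Finset.range L, cosFactor (n * δ l)) atTop
      (𝓝 (∫ ω, e n (X ω) ∂P).re) := by
    intro n
    have := (Complex.continuous_re.tendsto _).comp (hlim n)
    simpa only [Function.comp_def, hprod, Complex.ofReal_re] using this
  refine ⟨P.map fun ω => (X ω : UnitAddCircle), fun n => (∫ ω, e n (X ω) ∂P).re,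
    Measure.isProbabilityMeasure_map hXc.aemeasurable, fun n => ?_, hlim'⟩
  rw [integral_map hXc.aemeasurable (by fun_prop)]
  -- The approximating integrals are real, so their limit equals its own real part.
  refine tendsto_nhds_unique (hlim n) ?_
  simp only [hprod]
  exact (Complex.continuous_ofReal.tendsto _).comp (hlim' n)

/-! ### Construction of Gaussian measures with given covariance. -/

variable {Ω : Type*} {mΩ : MeasurableSpace Ω} {P : Measure Ω}

theorem norm_exp_I_mul_sub_le (a b : ℝ) :
    ‖Complex.exp (Complex.I * a) - Complex.exp (Complex.I * b)‖ ≤ |a - b| := by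
  have h : Complex.exp (Complex.I * a) - Complex.exp (Complex.I * b) =
      Complex.exp (Complex.I * b) * (Complex.exp (Complex.I * (a - b : ℝ)) - 1) := by
    rw [mul_sub, ← Complex.exp_add]; push_cast; ring_nf
  rw [h, norm_mul, Complex.norm_exp_I_mul_ofReal, one_mul]
  exact Real.norm_exp_I_mul_ofReal_sub_one_le

theorem integral_norm_le_norm_Lp [IsProbabilityMeasure P] (f : Lp ℝ 2 P) :
    ∫ ω, ‖f ω‖ ∂P ≤ ‖f‖ := by
  rw [Lp.norm_def, integral_norm_eq_lintegral_enorm (Lp.aestronglyMeasurable f),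
    ← eLpNorm_one_eq_lintegral_enorm]
  exact ENNReal.toReal_mono (Lp.eLpNorm_ne_top f)
    (eLpNorm_le_eLpNorm_of_exponent_le (by norm_num) (Lp.aestronglyMeasurable f))

theorem integrable_exp_I_mul [IsFiniteMeasure P] {f : Ω → ℝ} (hf : AEStronglyMeasurable f P) :
    Integrable (fun ω => Complex.exp (Complex.I * f ω)) P := by
  refine Integrable.of_bound (C := 1) ?_ (.of_forall fun ω => ?_)
  · exact (show Continuous fun x : ℝ => Complex.exp (Complex.I * x) by
      fun_prop).comp_aestronglyMeasurable hf
  · rw [Complex.norm_exp_I_mul_ofReal]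

/-- The property that `f` is centred Gaussian with variance `‖f‖²`, expressed through the
characteristic function at `1`, is closed in `L²`. -/
theorem isClosed_setOf_integral_exp_eq [IsProbabilityMeasure P] :
    IsClosed {f : Lp ℝ 2 P |
      ∫ ω, Complex.exp (Complex.I * f ω) ∂P = Complex.exp (-(‖f‖ : ℂ) ^ 2 / 2)} := by
  refine isClosed_eq ?_ (by fun_prop)
  refine (LipschitzWith.of_dist_le_mul (K := 1) fun f g => ?_).continuous
  rw [dist_eq_norm, dist_eq_norm, NNReal.coe_one, one_mul, ← integral_sub
    (integrable_exp_I_mul (Lp.aestronglyMeasurable f))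
    (integrable_exp_I_mul (Lp.aestronglyMeasurable g))]
  refine (norm_integral_le_integral_norm _).trans ((integral_mono_ae ?_ ?_ ?_).trans
    (integral_norm_le_norm_Lp (f - g)))
  · exact ((integrable_exp_I_mul (Lp.aestronglyMeasurable f)).sub
      (integrable_exp_I_mul (Lp.aestronglyMeasurable g))).norm
  · exact ((Lp.memLp (f - g)).integrable (by norm_num)).norm
  · filter_upwards [Lp.coeFn_sub f g] with ω hω
    rw [hω]
    exact norm_exp_I_mul_sub_le _ _

theorem coeFn_linearCombination_Lp {ι : Type*} (x : ι → Lp ℝ 2 P) (u : ι →₀ ℝ) :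
    ⇑(Finsupp.linearCombination ℝ x u) =ᵐ[P]
      fun ω => Finsupp.linearCombination ℝ (fun i => x i ω) u := by
  induction u using Finsupp.induction_linear with
  | zero =>
    rw [map_zero]
    filter_upwards [Lp.coeFn_zero ℝ 2 P] with ω hω
    rw [hω, map_zero, Pi.zero_apply]
  | add u w hu hw =>
    simp only [map_add]
    filter_upwards [hu, hw, Lp.coeFn_add (Finsupp.linearCombination ℝ x u)
      (Finsupp.linearCombination ℝ x w)] with ω h1 h2 h3
    rw [h3, Pi.add_apply, h1, h2]
  | single i a =>
    simp only [Finsupp.linearCombination_single]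
    filter_upwards [Lp.coeFn_smul a (x i)] with ω h1
    rw [h1, Pi.smul_apply]

theorem inner_linearCombination {ι E : Type*} [NormedAddCommGroup E] [InnerProductSpace ℝ E]
    (x y : ι → E) (u w : ι →₀ ℝ) :
    inner ℝ (Finsupp.linearCombination ℝ x u) (Finsupp.linearCombination ℝ y w) =
      u.sum fun i a => w.sum fun j b => a * b * inner ℝ (x i) (y j) := by
  simp only [Finsupp.linearCombination_apply, Finsupp.sum, sum_inner, inner_sum, inner_smul_left,
    inner_smul_right, Finset.mul_sum]
  rw [Finset.sum_comm]
  refine Finset.sum_congr rfl fun i _ => Finset.sum_congr rfl fun j _ => ?_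
  simp; ring

/-- The measure space of independent standard Gaussian variables. -/
abbrev gaussianProduct (ι : Type*) : Measure (ι → ℝ) :=
  Measure.infinitePi fun _ => gaussianReal 0 1

theorem memLp_eval_gaussianProduct {ι : Type*} (i : ι) :
    MemLp (fun ω : ι → ℝ => ω i) 2 (gaussianProduct ι) :=
  (memLp_id_gaussianReal 2).comp_measurePreserving
    (measurePreserving_eval_infinitePi (fun _ => gaussianReal 0 1) i)

theorem integral_exp_linearCombination_gaussianProduct {ι : Type*} (u : ι →₀ ℝ) :
    ∫ ω, Complex.exp (Complex.I * (Finsupp.linearCombination ℝ (fun i => ω i) u : ℝ))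
      ∂gaussianProduct ι = Complex.exp (-((∑ i ∈ u.support, u i ^ 2 : ℝ) : ℂ) / 2) := by
  have hind : iIndepFun (fun (i : u.support) (ω : ι → ℝ) =>
      Complex.exp (Complex.I * (u i * ω i : ℝ))) (gaussianProduct ι) := by
    have := iIndepFun_infinitePi (P := fun _ : ι => gaussianReal 0 1)
      (X := fun i x => Complex.exp (Complex.I * (u i * x : ℝ))) (fun i => by fun_prop)
    exact this.precomp Subtype.val_injective
  have h1 := hind.integral_fun_prod_eq_prod_integral fun i => by
    refine Measurable.aestronglyMeasurable ?_
    have := measurable_pi_apply (X := fun _ : ι => ℝ) (i : ι)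
    fun_prop
  have h2 : ∀ i : u.support, ∫ ω, Complex.exp (Complex.I * (u i * ω i : ℝ)) ∂gaussianProduct ι =
      Complex.exp (-((u i ^ 2 : ℝ) : ℂ) / 2) := by
    intro i
    have h3 := charFun_gaussianReal (μ := 0) (v := 1) (u i)
    rw [charFun_apply_real,
      ← (measurePreserving_eval_infinitePi (fun _ : ι => gaussianReal 0 1) (i : ι)).map_eq,
      integral_map (measurable_pi_apply _).aemeasurable
        (by fun_prop)] at h3
    convert h3 using 1
    · refine integral_congr_ae (.of_forall fun ω => ?_)
      simp only; congr 1; push_cast; ring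
    · congr 1; push_cast; simp; ring
  simp only [h2] at h1
  rw [← Complex.exp_sum] at h1
  convert h1 using 1
  · refine integral_congr_ae (.of_forall fun ω => ?_)
    simp only
    rw [← Complex.exp_sum, Finsupp.linearCombination_apply, Finsupp.sum, ← Finset.sum_coe_sort]
    simp [Finset.mul_sum]
  · congr 1
    rw [← Finset.sum_coe_sort]
    push_cast
    rw [← Finset.sum_neg_distrib, Finset.sum_div]

theorem orthonormal_eval_gaussianProduct (ι : Type*) :
    Orthonormal ℝ fun i : ι => (memLp_eval_gaussianProduct i).toLp fun ω : ι → ℝ => ω i := by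
  classical
  rw [orthonormal_iff_ite]
  intro i j
  rw [L2.inner_def]
  have h : ∫ ω, inner ℝ ((memLp_eval_gaussianProduct i).toLp (fun ω : ι → ℝ => ω i) ω)
      ((memLp_eval_gaussianProduct j).toLp (fun ω : ι → ℝ => ω j) ω) ∂gaussianProduct ι =
      ∫ ω : ι → ℝ, ω i * ω j ∂gaussianProduct ι := by
    refine integral_congr_ae ?_
    filter_upwards [(memLp_eval_gaussianProduct i).coeFn_toLp,
      (memLp_eval_gaussianProduct j).coeFn_toLp] with ω h1 h2
    rw [h1, h2]; simp [mul_comm]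
  rw [h]
  have hmean : ∀ i : ι, ∫ ω : ι → ℝ, ω i ∂gaussianProduct ι = 0 := by
    intro i
    have := integral_id_gaussianReal (μ := 0) (v := 1)
    rw [← (measurePreserving_eval_infinitePi (fun _ : ι => gaussianReal 0 1) i).map_eq,
      integral_map (measurable_pi_apply _).aemeasurable (by fun_prop)] at this
    exact this
  split_ifs with hij
  · subst hij
    have h1 := variance_id_gaussianReal (μ := 0) (v := 1)
    rw [variance_eq_integral (by fun_prop)] at h1
    simp only [id, integral_id_gaussianReal, sub_zero] at h1
    rw [← (measurePreserving_eval_infinitePi (fun _ : ι => gaussianReal 0 1) i).map_eq,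
      integral_map (measurable_pi_apply _).aemeasurable (by fun_prop)] at h1
    simpa [pow_two] using h1
  · have hind : IndepFun (fun ω : ι → ℝ => ω i) (fun ω => ω j) (gaussianProduct ι) :=
      (iIndepFun_infinitePi (P := fun _ : ι => gaussianReal 0 1) (X := fun _ x => x)
        (fun _ => measurable_id)).indepFun hij
    rw [hind.integral_fun_mul_eq_mul_integral
      (memLp_eval_gaussianProduct i).1 (memLp_eval_gaussianProduct j).1, hmean, zero_mul]

/-- Coordinates in `b` identify `H` with `ℓ²`, which embeds into `E` through the orthonormal family
`g`; `g` need not span `E`. -/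
theorem exists_linearIsometry_hilbertBasis {ι H E : Type*} [NormedAddCommGroup H]
    [InnerProductSpace ℝ H] [NormedAddCommGroup E] [InnerProductSpace ℝ E] [CompleteSpace E]
    (b : HilbertBasis ι ℝ H) {g : ι → E} (hg : Orthonormal ℝ g) :
    ∃ W : H →ₗᵢ[ℝ] E, ∀ i, W (b i) = g i := by
  classical
  refine ⟨hg.orthogonalFamily.linearIsometry.comp b.repr.toLinearIsometry, fun i => ?_⟩
  have h := hg.orthogonalFamily.linearIsometry_apply_single (i := i) (1 : ℝ)
  rw [← b.repr_self] at h
  exact h.trans (by simp)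

/-- Every real Hilbert space carries an isonormal Gaussian process. -/
theorem exists_isonormal (H : Type) [NormedAddCommGroup H] [InnerProductSpace ℝ H]
    [CompleteSpace H] :
    ∃ (Ω : Type) (_ : MeasurableSpace Ω) (P : Measure Ω) (_ : IsProbabilityMeasure P)
      (W : H →ₗᵢ[ℝ] Lp ℝ 2 P), ∀ h, ∫ ω, Complex.exp (Complex.I * W h ω) ∂P =
        Complex.exp (-(‖h‖ : ℂ) ^ 2 / 2) := by
  classical
  obtain ⟨w, b, -⟩ := exists_hilbertBasis ℝ H
  let g : w → Lp ℝ 2 (gaussianProduct w) := fun i =>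
    (memLp_eval_gaussianProduct i).toLp fun ω => ω i
  have hg : Orthonormal ℝ g := orthonormal_eval_gaussianProduct w
  obtain ⟨W, hWb⟩ := exists_linearIsometry_hilbertBasis b hg
  refine ⟨w → ℝ, inferInstance, gaussianProduct w, inferInstance, W, fun h => ?_⟩
  have hclosed : IsClosed {h : H | ∫ ω, Complex.exp (Complex.I * W h ω) ∂gaussianProduct w =
      Complex.exp (-(‖h‖ : ℂ) ^ 2 / 2)} := by
    have := (isClosed_setOf_integral_exp_eq (P := gaussianProduct w)).preimage W.continuous
    simpa only [Set.preimage_ofPred_eq, LinearIsometry.norm_map] using this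
  have hspan : (Submodule.span ℝ (Set.range b) : Set H) ⊆
      {h : H | ∫ ω, Complex.exp (Complex.I * W h ω) ∂gaussianProduct w =
        Complex.exp (-(‖h‖ : ℂ) ^ 2 / 2)} := by
    intro h hh
    obtain ⟨u, rfl⟩ := (Finsupp.mem_span_range_iff_exists_finsupp).1 hh
    have hW : W (u.sum fun i a => a • b i) = Finsupp.linearCombination ℝ g u := by
      rw [Finsupp.linearCombination_apply, Finsupp.sum, map_sum]
      simp [Finsupp.sum, hWb]
    have hnorm : ‖u.sum fun i a => a • b i‖ ^ 2 = ∑ i ∈ u.support, u i ^ 2 := by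
      rw [← W.norm_map, hW, ← real_inner_self_eq_norm_sq, hg.inner_finsupp_eq_sum_left]
      simp [Finsupp.sum, pow_two]
    rw [Set.mem_ofPred_eq, ← Complex.ofReal_pow, hnorm,
      ← integral_exp_linearCombination_gaussianProduct, hW]
    refine integral_congr_ae ?_
    filter_upwards [coeFn_linearCombination_Lp g u,
      (Filter.eventually_all_finset u.support).2 fun i _ =>
        (memLp_eval_gaussianProduct i).coeFn_toLp] with ω h1 h2
    rw [h1]
    congr 3
    simp only [Finsupp.linearCombination_apply, Finsupp.sum]
    refine Finset.sum_congr rfl fun i hi => ?_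
    rw [← h2 i hi]
  have := hclosed.closure_subset_iff.2 hspan
  rw [← Submodule.topologicalClosure_coe, b.dense_span] at this
  exact this trivial

/-- A Gaussian measure on `ℝ^ℤ` with prescribed covariance `⟪f n, f m⟫`. -/
theorem exists_gaussianMeasure {H : Type} [NormedAddCommGroup H] [InnerProductSpace ℝ H]
    [CompleteSpace H] (f : ℤ → H) :
    ∃ γ : Measure (ℤ → ℝ), IsProbabilityMeasure γ ∧ (∀ n, MemLp (coord n) 2 γ) ∧
      (∀ m n, ∫ ω, coord n ω * coord m ω ∂γ = inner ℝ (f n) (f m)) ∧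
      ∀ u : ℤ →₀ ℝ, ∫ ω, Complex.exp (Complex.I * (Finsupp.linearCombination ℝ ω u : ℝ)) ∂γ =
        Complex.exp (-(‖Finsupp.linearCombination ℝ f u‖ : ℂ) ^ 2 / 2) := by
  obtain ⟨Ω, _, P, _, W, hW⟩ := exists_isonormal H
  let X : Ω → ℤ → ℝ := fun ω n => W (f n) ω
  have hX : Measurable X := measurable_pi_lambda _ fun n => (Lp.stronglyMeasurable _).measurable
  have hcoord : ∀ n, Measurable (coord n) := fun n => measurable_pi_apply n
  refine ⟨P.map X, Measure.isProbabilityMeasure_map hX.aemeasurable, fun n => ?_, fun m n => ?_,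
    fun u => ?_⟩
  · rw [memLp_map_measure_iff (hcoord n).aestronglyMeasurable hX.aemeasurable]
    exact Lp.memLp (W (f n))
  · rw [integral_map (f := fun ω => coord n ω * coord m ω) hX.aemeasurable
      ((hcoord n).mul (hcoord m)).aestronglyMeasurable, ← W.inner_map_map, L2.inner_def]
    refine integral_congr_ae (.of_forall fun ω => ?_)
    simp [coord, X, mul_comm]
  · have hm : Measurable fun ω : ℤ → ℝ => Finsupp.linearCombination ℝ ω u := by
      simp only [Finsupp.linearCombination_apply, Finsupp.sum]
      fun_prop
    rw [integral_map hX.aemeasurable (by fun_prop), ← hW]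
    refine integral_congr_ae ?_
    filter_upwards [coeFn_linearCombination_Lp (fun n => W (f n)) u] with ω hω
    simp only [X]
    rw [← hω]
    congr 3
    simp [Finsupp.linearCombination_apply, Finsupp.sum]

/-- The characters in `L²(ρ)`, viewed as a real Hilbert space. Taking real parts of inner products
loses nothing because the coefficients are real. -/
theorem exists_hilbert_fourier (ρ : Measure UnitAddCircle) [IsFiniteMeasure ρ] {c : ℤ → ℝ}
    (hc : ∀ n, ∫ x, fourier n x ∂ρ = c n) :
    ∃ (H : Type) (_ : NormedAddCommGroup H) (_ : InnerProductSpace ℝ H) (_ : CompleteSpace H)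
      (f : ℤ → H), ∀ m n, inner ℝ (f n) (f m) = c (m - n) := by
  refine ⟨Lp ℂ 2 ρ, inferInstance, InnerProductSpace.complexToReal, inferInstance,
    fun n => ContinuousMap.toLp 2 ρ ℂ (fourier n), fun m n => ?_⟩
  rw [real_inner_eq_re_inner ℂ, ContinuousMap.inner_toLp]
  have : ∫ x, fourier m x * (starRingEnd ℂ) (fourier n x) ∂ρ = c (m - n) := by
    rw [← hc]
    refine integral_congr_ae (.of_forall fun x => ?_)
    simp only
    rw [← fourier_neg, ← fourier_add, sub_eq_add_neg]
  rw [this]; simp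

/-- A measure with Gaussian characteristic functions is the Gaussian measure associated with
its spectral measure. -/
theorem isGaussianMeasureOf {H : Type*} [NormedAddCommGroup H] [InnerProductSpace ℝ H]
    {f : ℤ → H} {ρ : Measure UnitAddCircle} {c : ℤ → ℝ} (hc : ∀ n, ∫ x, fourier n x ∂ρ = c n)
    (hf : ∀ m n, inner ℝ (f n) (f m) = c (m - n)) {γ : Measure (ℤ → ℝ)} [IsProbabilityMeasure γ]
    (hL : ∀ n, MemLp (coord n) 2 γ)
    (hcov : ∀ m n, ∫ ω, coord n ω * coord m ω ∂γ = inner ℝ (f n) (f m))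
    (hchar : ∀ u : ℤ →₀ ℝ,
      ∫ ω, Complex.exp (Complex.I * (Finsupp.linearCombination ℝ ω u : ℝ)) ∂γ =
        Complex.exp (-(‖Finsupp.linearCombination ℝ f u‖ : ℂ) ^ 2 / 2)) :
    IsGaussianMeasureOf ρ γ := by
  refine ⟨inferInstance, hL, fun g hg => ?_, fun m n => by rw [hcov, hf, hc]⟩
  let x : ℤ → Lp ℝ 2 γ := fun n => (hL n).toLp (coord n)
  have hx : ∀ n m, inner ℝ (x n) (x m) = inner ℝ (f n) (f m) := by
    intro n m
    rw [← hcov, L2.inner_def]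
    refine integral_congr_ae ?_
    filter_upwards [(hL n).coeFn_toLp, (hL m).coeFn_toLp] with ω h1 h2
    simp only [x]
    rw [h1, h2]; simp [mul_comm]
  have hspan : (Submodule.span ℝ (Set.range x) : Set (Lp ℝ 2 γ)) ⊆ {g : Lp ℝ 2 γ |
      ∫ ω, Complex.exp (Complex.I * g ω) ∂γ = Complex.exp (-(‖g‖ : ℂ) ^ 2 / 2)} := by
    intro g hg
    obtain ⟨u, rfl⟩ := (Finsupp.mem_span_range_iff_exists_finsupp).1 hg
    have hu : (u.sum fun i a => a • x i) = Finsupp.linearCombination ℝ x u := rfl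
    have hnorm : ‖Finsupp.linearCombination ℝ x u‖ ^ 2 = ‖Finsupp.linearCombination ℝ f u‖ ^ 2 := by
      rw [← real_inner_self_eq_norm_sq, ← real_inner_self_eq_norm_sq, inner_linearCombination,
        inner_linearCombination]
      simp only [hx]
    rw [hu, Set.mem_ofPred_eq, ← Complex.ofReal_pow, hnorm, Complex.ofReal_pow, ← hchar]
    refine integral_congr_ae ?_
    filter_upwards [coeFn_linearCombination_Lp x u,
      (Filter.eventually_all_finset u.support).2 fun i _ => (hL i).coeFn_toLp] with ω h1 h2
    rw [h1]
    congr 3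
    simp only [Finsupp.linearCombination_apply, Finsupp.sum]
    refine Finset.sum_congr rfl fun i hi => ?_
    rw [h2 i hi, coord]
  have hall : ∀ g ∈ firstChaos γ hL,
      ∫ ω, Complex.exp (Complex.I * g ω) ∂γ = Complex.exp (-(‖g‖ : ℂ) ^ 2 / 2) := fun g hg =>
    (isClosed_setOf_integral_exp_eq.closure_subset_iff.2 hspan) hg
  refine ⟨‖g‖₊ ^ 2, ?_⟩
  have hgm := (Lp.stronglyMeasurable g).measurable
  have := Measure.isProbabilityMeasure_map (μ := γ) hgm.aemeasurable
  refine Measure.ext_of_charFun (funext fun t => ?_)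
  rw [charFun_gaussianReal, charFun_apply_real, integral_map hgm.aemeasurable (by fun_prop)]
  -- `firstChaos` is closed under scaling, so the identity at `1` for `t • g` is the characteristic
  -- function of `g` at `t`.
  have h1 := hall (t • g) (Submodule.smul_mem _ t hg)
  rw [norm_smul] at h1
  refine Eq.trans (integral_congr_ae ?_) (h1.trans ?_)
  · filter_upwards [Lp.coeFn_smul t g] with ω hω
    rw [hω]
    simp [mul_comm]
  · congr 1
    have : ((‖t‖ : ℂ)) ^ 2 = (t : ℂ) ^ 2 := by norm_cast; simp
    push_cast
    rw [mul_pow, this]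
    ring

/-! ### Exponentials of linear functionals and their density in `L²`. -/

theorem measurable_linearCombination (u : ℤ →₀ ℝ) :
    Measurable fun ω : ℤ → ℝ => Finsupp.linearCombination ℝ ω u := by
  simp only [Finsupp.linearCombination_apply, Finsupp.sum]
  fun_prop

theorem continuous_linearCombination (u : ℤ →₀ ℝ) :
    Continuous fun ω : ℤ → ℝ => Finsupp.linearCombination ℝ ω u := by
  simp only [Finsupp.linearCombination_apply, Finsupp.sum]
  fun_prop

/-- The exponential function `ω ↦ exp (i ∑ u l * ω l)` on `ℝ^ℤ`. -/
def expFun (u : ℤ →₀ ℝ) (ω : ℤ → ℝ) : ℂ :=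
  Complex.exp (Complex.I * (Finsupp.linearCombination ℝ ω u : ℝ))

theorem measurable_expFun (u : ℤ →₀ ℝ) : Measurable (expFun u) := by
  have := measurable_linearCombination u
  unfold expFun
  fun_prop

theorem norm_expFun (u : ℤ →₀ ℝ) (ω : ℤ → ℝ) : ‖expFun u ω‖ = 1 :=
  Complex.norm_exp_I_mul_ofReal _

theorem conj_expFun (u : ℤ →₀ ℝ) (ω : ℤ → ℝ) :
    (starRingEnd ℂ) (expFun u ω) = expFun (-u) ω := by
  simp [expFun, ← Complex.exp_conj]

theorem expFun_add (u w : ℤ →₀ ℝ) (ω : ℤ → ℝ) : expFun (u + w) ω = expFun u ω * expFun w ω := by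
  simp [expFun, ← Complex.exp_add, mul_add]

theorem expFun_zero (ω : ℤ → ℝ) : expFun 0 ω = 1 := by simp [expFun]

/-- Finite measures on `ℝ^ℤ` are determined by their characteristic function. -/
theorem measure_ext_of_integral_expFun {μ ν : Measure (ℤ → ℝ)} [IsFiniteMeasure μ]
    [IsFiniteMeasure ν] (h : ∀ u, ∫ ω, expFun u ω ∂μ = ∫ ω, expFun u ω ∂ν) : μ = ν := by
  let := TopologicalSpace.upgradeIsCompletelyMetrizable (ℤ → ℝ)
  -- With the discrete topology on functionals, joint continuity of the pairing reduces to
  -- continuity of each functional.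
  let : TopologicalSpace (ℤ →₀ ℝ) := ⊥
  have : DiscreteTopology (ℤ →₀ ℝ) := ⟨rfl⟩
  let L : (ℤ → ℝ) →ₗ[ℝ] (ℤ →₀ ℝ) →ₗ[ℝ] ℝ :=
    LinearMap.mk₂ ℝ (fun ω u => Finsupp.linearCombination ℝ ω u)
      (fun ω ω' u => by
        simp [Finsupp.linearCombination_apply, Finsupp.sum, mul_add, Finset.sum_add_distrib])
      (fun a ω u => by
        simp [Finsupp.linearCombination_apply, Finsupp.sum, Finset.mul_sum, mul_left_comm])
      (fun ω u w => map_add _ _ _) (fun a ω u => map_smul _ _ _)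
  have hL : Continuous fun p : (ℤ → ℝ) × (ℤ →₀ ℝ) => L p.1 p.2 :=
    continuous_prod_of_discrete_right.2 fun u => continuous_linearCombination u
  refine ext_of_integral_char_eq (L := L) Real.continuous_probChar Real.probChar_ne_one (fun v hv hLv => ?_)
    hL fun u => ?_
  · apply hv
    funext n
    have := LinearMap.congr_fun hLv (Finsupp.single n 1)
    simpa [L] using this
  · have := h u
    simpa [expFun, L, BoundedContinuousFunction.char_apply, Real.probChar_apply, mul_comm] using this

/-- The positive and negative parts of `g` are densities of finite measures with the same
characteristic function, so these measures coincide. -/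
theorem ae_eq_zero_of_integral_mul_expFun {γ : Measure (ℤ → ℝ)} [IsFiniteMeasure γ]
    {g : (ℤ → ℝ) → ℝ} (hg : Integrable g γ) (h : ∀ u, ∫ ω, (g ω : ℂ) * expFun u ω ∂γ = 0) :
    g =ᵐ[γ] 0 := by
  have hfin : ∀ {g : (ℤ → ℝ) → ℝ}, Integrable g γ →
      IsFiniteMeasure (γ.withDensity fun ω => ENNReal.ofReal (g ω)) := fun hg =>
    isFiniteMeasure_withDensity_ofReal hg.2
  have h1 := hfin hg
  have h2 := hfin hg.neg
  have hint : ∀ {g : (ℤ → ℝ) → ℝ}, Integrable g γ → ∀ u,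
      ∫ ω, expFun u ω ∂(γ.withDensity fun ω => ENNReal.ofReal (g ω)) =
        ∫ ω, ((max (g ω) 0 : ℝ) : ℂ) * expFun u ω ∂γ := by
    intro g hg u
    rw [integral_withDensity_eq_integral_toReal_smul₀ hg.1.aemeasurable.ennreal_ofReal
      (.of_forall fun _ => ENNReal.ofReal_lt_top)]
    refine integral_congr_ae (.of_forall fun ω => ?_)
    simp [ENNReal.toReal_ofReal']
  have hint' : ∀ {g : (ℤ → ℝ) → ℝ}, Integrable g γ → ∀ u,
      Integrable (fun ω => ((max (g ω) 0 : ℝ) : ℂ) * expFun u ω) γ := by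
    intro g hg u
    exact hg.pos_part.ofReal.mul_bdd (c := 1) (measurable_expFun u).aestronglyMeasurable
      (.of_forall fun ω => (norm_expFun u ω).le)
  have heq := measure_ext_of_integral_expFun (μ := γ.withDensity fun ω => ENNReal.ofReal (g ω))
    (ν := γ.withDensity fun ω => ENNReal.ofReal ((-g) ω)) fun u => by
      rw [hint hg, hint hg.neg, ← sub_eq_zero, ← integral_sub (hint' hg u) (hint' hg.neg u), ← h u]
      refine integral_congr_ae (.of_forall fun ω => ?_)
      simp only [Pi.neg_apply]
      rw [← sub_mul, ← Complex.ofReal_sub, max_zero_sub_eq_self]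
  rw [withDensity_eq_iff hg.1.aemeasurable.ennreal_ofReal hg.neg.1.aemeasurable.ennreal_ofReal
    hg.lintegral_lt_top.ne] at heq
  filter_upwards [heq] with ω hω
  rw [Pi.neg_apply] at hω
  rw [Pi.zero_apply]
  rcases le_total (g ω) 0 with h0 | h0
  · rw [ENNReal.ofReal_of_nonpos h0, eq_comm, ENNReal.ofReal_eq_zero] at hω
    exact le_antisymm h0 (by linarith)
  · rw [ENNReal.ofReal_of_nonpos (by linarith : -g ω ≤ 0), ENNReal.ofReal_eq_zero] at hω
    exact le_antisymm hω h0

theorem memLp_expFun (γ : Measure (ℤ → ℝ)) [IsFiniteMeasure γ] (u : ℤ →₀ ℝ) :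
    MemLp (expFun u) 2 γ :=
  MemLp.of_bound (measurable_expFun u).aestronglyMeasurable 1
    (.of_forall fun ω => (norm_expFun u ω).le)

/-- The exponential functions as elements of `L²`. -/
def expLp (γ : Measure (ℤ → ℝ)) [IsFiniteMeasure γ] (u : ℤ →₀ ℝ) : Lp ℂ 2 γ :=
  (memLp_expFun γ u).toLp (expFun u)

theorem coeFn_expLp (γ : Measure (ℤ → ℝ)) [IsFiniteMeasure γ] (u : ℤ →₀ ℝ) :
    expLp γ u =ᵐ[γ] expFun u := (memLp_expFun γ u).coeFn_toLp

/-- The exponential functions span a dense subspace of `L²`. -/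
theorem span_expLp_topologicalClosure (γ : Measure (ℤ → ℝ)) [IsFiniteMeasure γ] :
    (Submodule.span ℂ (Set.range (expLp γ))).topologicalClosure = ⊤ := by
  rw [Submodule.topologicalClosure_eq_top_iff, Submodule.eq_bot_iff]
  intro g hg
  have hgint : Integrable g γ := (Lp.memLp g).integrable (by norm_num)
  have h1 : ∀ u, ∫ ω, g ω * expFun u ω ∂γ = 0 := by
    intro u
    have h2 := (Submodule.mem_orthogonal _ g).1 hg (expLp γ (-u))
      (Submodule.subset_span ⟨-u, rfl⟩)
    rw [L2.inner_def] at h2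
    rw [← h2]
    refine integral_congr_ae ?_
    filter_upwards [coeFn_expLp γ (-u)] with ω hω
    rw [hω, RCLike.inner_apply, conj_expFun, neg_neg]
  -- The exponentials are closed under conjugation, so the conjugate of `g` is annihilated too; this
  -- isolates the real and imaginary parts.
  have h2 : ∀ u, ∫ ω, (starRingEnd ℂ) (g ω) * expFun u ω ∂γ = 0 := by
    intro u
    have h3 := congrArg (starRingEnd ℂ) (h1 (-u))
    rw [← integral_conj, map_zero] at h3
    simpa [conj_expFun] using h3
  have hi : ∀ u, Integrable (fun ω => g ω * expFun u ω) γ := fun u =>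
    hgint.mul_bdd (c := 1) (measurable_expFun u).aestronglyMeasurable
      (.of_forall fun ω => (norm_expFun u ω).le)
  have hgc : Integrable (fun ω => (starRingEnd ℂ) (g ω)) γ :=
    (LinearIsometryEquiv.integrable_comp_iff Complex.conjLIE).2 hgint
  have hi' : ∀ u, Integrable (fun ω => (starRingEnd ℂ) (g ω) * expFun u ω) γ := fun u =>
    hgc.mul_bdd (c := 1) (measurable_expFun u).aestronglyMeasurable
      (.of_forall fun ω => (norm_expFun u ω).le)
  have hre := ae_eq_zero_of_integral_mul_expFun (g := fun ω => (g ω).re) hgint.re fun u => by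
    have : ∀ ω, (((g ω).re : ℝ) : ℂ) * expFun u ω =
        (1 / 2) * (g ω * expFun u ω + (starRingEnd ℂ) (g ω) * expFun u ω) := by
      intro ω
      rw [← add_mul, Complex.add_conj]; push_cast; ring
    simp only [this]
    rw [integral_const_mul, integral_add (hi u) (hi' u), h1, h2]; simp
  have him := ae_eq_zero_of_integral_mul_expFun (g := fun ω => (g ω).im) hgint.im fun u => by
    have : ∀ ω, (((g ω).im : ℝ) : ℂ) * expFun u ω =
        (-Complex.I / 2) * (g ω * expFun u ω - (starRingEnd ℂ) (g ω) * expFun u ω) := by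
      intro ω
      rw [← sub_mul, Complex.sub_conj]
      push_cast
      linear_combination ((((g ω).im : ℝ) : ℂ) * expFun u ω) * Complex.I_sq
    simp only [this]
    rw [integral_const_mul, integral_sub (hi u) (hi' u), h1, h2]; simp
  rw [Lp.eq_zero_iff_ae_eq_zero]
  filter_upwards [hre, him] with ω h3 h4
  exact Complex.ext h3 h4

/-! ### The shift and the passage from covariances to correlations. -/

theorem shift_zpow_apply (n : ℤ) (ω : ℤ → ℝ) (l : ℤ) : (shift ^ n) ω l = ω (l + n) := by
  have hnat : ∀ (n : ℕ) (ω : ℤ → ℝ) (l : ℤ), (shift ^ n) ω l = ω (l + n) := by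
    intro n
    induction n with
    | zero => simp
    | succ n ih =>
      intro ω l
      rw [pow_succ', Equiv.Perm.mul_apply]
      change (shift ^ n) ω (l + 1) = _
      rw [ih]; congr 1; push_cast; ring
  obtain ⟨n, rfl | rfl⟩ := n.eq_nat_or_neg
  · rw [zpow_natCast, hnat]
  · have : ω = (shift ^ n) ((shift ^ (-(n : ℤ))) ω) := by
      rw [zpow_neg, zpow_natCast, ← Equiv.Perm.mul_apply, mul_inv_cancel, Equiv.Perm.one_apply]
    conv_rhs => rw [this]
    rw [hnat, neg_add_cancel_right]

theorem measurable_shift_zpow (n : ℤ) : Measurable ⇑(shift ^ n) :=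
  measurable_pi_lambda _ fun l => by
    simp only [shift_zpow_apply]; exact measurable_pi_apply _

/-- Translation of the coefficients of a linear functional. -/
def translate (n : ℤ) (u : ℤ →₀ ℝ) : ℤ →₀ ℝ := u.mapDomain (· + n)

theorem linearCombination_translate {E : Type*} [AddCommGroup E] [Module ℝ E] (f : ℤ → E) (n : ℤ)
    (u : ℤ →₀ ℝ) : Finsupp.linearCombination ℝ f (translate n u) =
      Finsupp.linearCombination ℝ (fun l => f (l + n)) u := by
  rw [translate, Finsupp.linearCombination_mapDomain]; rfl

theorem expFun_shift_zpow (n : ℤ) (u : ℤ →₀ ℝ) (ω : ℤ → ℝ) :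
    expFun u ((shift ^ n) ω) = expFun (translate n u) ω := by
  rw [expFun, expFun, linearCombination_translate]
  congr 5
  exact funext fun l => shift_zpow_apply n ω l

theorem AvgZero.sum {F : ℕ → Finset ℤ} {ι : Type*} (s : Finset ι) {d : ι → ℤ → ℝ}
    (h : ∀ i ∈ s, AvgZero F (d i)) : AvgZero F fun n => ∑ i ∈ s, d i n := by
  classical
  induction s using Finset.induction_on with
  | empty => simpa using AvgZero.zero
  | insert i s hi ih =>
    simp only [Finset.sum_insert hi]
    exact (h i (Finset.mem_insert_self i s)).add
      (ih fun j hj => h j (Finset.mem_insert_of_mem hj))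

theorem abs_exp_sub_exp_le {a b C : ℝ} (ha : a ≤ C) (hb : b ≤ C) :
    |Real.exp a - Real.exp b| ≤ Real.exp C * |a - b| := by
  wlog hab : b ≤ a generalizing a b
  · rw [abs_sub_comm, abs_sub_comm a]
    exact this hb ha (le_of_not_ge hab)
  rw [abs_of_nonneg (sub_nonneg.2 (Real.exp_le_exp.2 hab)), abs_of_nonneg (sub_nonneg.2 hab)]
  have h1 : Real.exp b = Real.exp a * Real.exp (b - a) := by rw [← Real.exp_add]; congr 1; ring
  have h2 := Real.add_one_le_exp (b - a)
  have h3 := Real.exp_le_exp.2 ha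
  calc Real.exp a - Real.exp b = Real.exp a * (1 - Real.exp (b - a)) := by rw [h1]; ring
    _ ≤ Real.exp a * (a - b) := mul_le_mul_of_nonneg_left (by linarith) (Real.exp_pos a).le
    _ ≤ _ := by gcongr

section Correlation

variable {H : Type*} [NormedAddCommGroup H] [InnerProductSpace ℝ H] {f : ℤ → H} {c : ℤ → ℝ}
  {γ : Measure (ℤ → ℝ)} [IsProbabilityMeasure γ]

theorem norm_linearCombination_translate (hf : ∀ m n, inner ℝ (f n) (f m) = c (m - n)) (n : ℤ)
    (u : ℤ →₀ ℝ) : ‖Finsupp.linearCombination ℝ f (translate n u)‖ =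
      ‖Finsupp.linearCombination ℝ f u‖ := by
  rw [linearCombination_translate, ← sq_eq_sq₀ (norm_nonneg _) (norm_nonneg _),
    ← real_inner_self_eq_norm_sq, ← real_inner_self_eq_norm_sq, inner_linearCombination,
    inner_linearCombination]
  simp [hf]

theorem measurePreserving_shift_zpow (hf : ∀ m n, inner ℝ (f n) (f m) = c (m - n))
    (hchar : ∀ u, ∫ ω, expFun u ω ∂γ =
      Complex.exp (-(‖Finsupp.linearCombination ℝ f u‖ : ℂ) ^ 2 / 2)) (n : ℤ) :
    MeasurePreserving (shift ^ n) γ γ := by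
  refine ⟨measurable_shift_zpow n, ?_⟩
  have := Measure.isProbabilityMeasure_map (μ := γ) (measurable_shift_zpow n).aemeasurable
  refine measure_ext_of_integral_expFun fun u => ?_
  rw [integral_map (measurable_shift_zpow n).aemeasurable
    (measurable_expFun u).aestronglyMeasurable]
  simp only [expFun_shift_zpow, hchar, norm_linearCombination_translate hf]

/-- By bilinearity, only finitely many covariances `c (n + (j - i))` are involved. -/
theorem avgZero_inner_translate {F : ℕ → Finset ℤ} (hf : ∀ m n, inner ℝ (f n) (f m) = c (m - n))
    {β : ℝ} (h : ∀ a, AvgZero F fun n => |c (n + a) - β * c a|) (u w : ℤ →₀ ℝ) :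
    AvgZero F fun n => |inner ℝ (Finsupp.linearCombination ℝ f u)
      (Finsupp.linearCombination ℝ f (translate n w)) -
        β * inner ℝ (Finsupp.linearCombination ℝ f u) (Finsupp.linearCombination ℝ f w)| := by
  have h1 : AvgZero F fun n => ∑ i ∈ u.support, ∑ j ∈ w.support,
      |u i * w j| * |c (n + (j - i)) - β * c (j - i)| :=
    AvgZero.sum _ fun i _ => AvgZero.sum _ fun j _ => (h (j - i)).const_mul _
  refine h1.mono (fun n => abs_nonneg _) fun n => ?_
  rw [linearCombination_translate, inner_linearCombination, inner_linearCombination]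
  simp only [Finsupp.sum, Finset.mul_sum, ← Finset.sum_sub_distrib]
  refine (Finset.abs_sum_le_sum_abs _ _).trans (Finset.sum_le_sum fun i _ => ?_)
  refine (Finset.abs_sum_le_sum_abs _ _).trans (Finset.sum_le_sum fun j _ => ?_)
  rw [← abs_mul, hf, hf]
  refine le_of_eq (congrArg _ ?_)
  rw [show j + n - i = n + (j - i) by ring]
  ring

/-- The integrand is the exponential of `translate n w - u`; expanding the squared norm leaves `n`
only in the cross term. -/
theorem inner_expLp_compMeasurePreserving (hf : ∀ m n, inner ℝ (f n) (f m) = c (m - n))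
    (hchar : ∀ u, ∫ ω, expFun u ω ∂γ =
      Complex.exp (-(‖Finsupp.linearCombination ℝ f u‖ : ℂ) ^ 2 / 2))
    (hmp : ∀ n : ℤ, MeasurePreserving (shift ^ n) γ γ) (n : ℤ) (u w : ℤ →₀ ℝ) :
    inner ℂ (expLp γ u) (Lp.compMeasurePreservingₗᵢ ℂ _ (hmp n) (expLp γ w)) =
      ((Real.exp (-(‖Finsupp.linearCombination ℝ f u‖ ^ 2 +
        ‖Finsupp.linearCombination ℝ f w‖ ^ 2) / 2) *
          Real.exp (inner ℝ (Finsupp.linearCombination ℝ f u)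
            (Finsupp.linearCombination ℝ f (translate n w))) : ℝ) : ℂ) := by
  rw [L2.inner_def]
  have h1 : ∫ ω, inner ℂ (expLp γ u ω)
      (Lp.compMeasurePreservingₗᵢ ℂ _ (hmp n) (expLp γ w) ω) ∂γ =
      ∫ ω, expFun (translate n w - u) ω ∂γ := by
    refine integral_congr_ae ?_
    filter_upwards [coeFn_expLp γ u, Lp.coeFn_compMeasurePreserving (expLp γ w) (hmp n),
      (hmp n).quasiMeasurePreserving.ae_eq_comp (coeFn_expLp γ w)] with ω h1 h2 h3
    change inner ℂ (expLp γ u ω) (Lp.compMeasurePreserving _ (hmp n) (expLp γ w) ω) = _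
    rw [h2, h3, h1, RCLike.inner_apply, conj_expFun, Function.comp_apply, expFun_shift_zpow,
      ← expFun_add, sub_eq_add_neg]
  rw [h1, hchar, map_sub, ← Real.exp_add, Complex.ofReal_exp, ← Complex.ofReal_pow,
    norm_sub_sq_real, norm_linearCombination_translate hf, real_inner_comm]
  congr 1
  push_cast
  ring

/-- The deviation of the correlations at time `n` from their expected limit. -/
def corrDefect (hmp : ∀ n : ℤ, MeasurePreserving (shift ^ n) γ γ) (ξ : ℝ) (n : ℤ)
    (g h : Lp ℂ 2 γ) : ℝ :=
  ‖inner ℂ g (Lp.compMeasurePreservingₗᵢ ℂ _ (hmp n) h) -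
    ((1 - ξ) * inner ℂ g h + ξ * (inner ℂ g (expLp γ 0) * inner ℂ (expLp γ 0) h))‖

theorem corrDefect_le (hmp : ∀ n : ℤ, MeasurePreserving (shift ^ n) γ γ) (ξ : ℝ) (n : ℤ)
    (g h : Lp ℂ 2 γ) :
    corrDefect hmp ξ n g h ≤ (1 + |1 - ξ| + |ξ| * ‖expLp γ 0‖ ^ 2) * ‖g‖ * ‖h‖ := by
  have h1 := norm_inner_le_norm (𝕜 := ℂ) g (Lp.compMeasurePreservingₗᵢ ℂ _ (hmp n) h)
  rw [LinearIsometry.norm_map] at h1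
  have h2 := norm_inner_le_norm (𝕜 := ℂ) g h
  have h3 := norm_inner_le_norm (𝕜 := ℂ) g (expLp γ 0)
  have h4 := norm_inner_le_norm (𝕜 := ℂ) (expLp γ 0) h
  have h5 : ‖((1 : ℂ) - ξ)‖ = |1 - ξ| := by
    rw [← Complex.ofReal_one, ← Complex.ofReal_sub, Complex.norm_real, Real.norm_eq_abs]
  refine (norm_sub_le _ _).trans ((add_le_add_right (norm_add_le _ _) _).trans ?_)
  rw [norm_mul, norm_mul, norm_mul, h5, Complex.norm_real, Real.norm_eq_abs]
  calc _ ≤ ‖g‖ * ‖h‖ + (|1 - ξ| * (‖g‖ * ‖h‖) +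
        |ξ| * ((‖g‖ * ‖expLp γ 0‖) * (‖expLp γ 0‖ * ‖h‖))) := by gcongr
    _ = _ := by ring

theorem avgZero_corrDefect {F : ℕ → Finset ℤ}
    (hf : ∀ m n, inner ℝ (f n) (f m) = c (m - n))
    (hchar : ∀ u, ∫ ω, expFun u ω ∂γ =
      Complex.exp (-(‖Finsupp.linearCombination ℝ f u‖ : ℂ) ^ 2 / 2))
    (hmp : ∀ n : ℤ, MeasurePreserving (shift ^ n) γ γ) {ξ : ℝ} (hξ : ξ = 0 ∨ ξ = 1)
    (h : ∀ a, AvgZero F fun n => |c (n + a) - (1 - ξ) * c a|) (g g' : Lp ℂ 2 γ) :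
    AvgZero F fun n => corrDefect hmp ξ n g g' := by
  have hexp : ∀ u w, AvgZero F fun n => corrDefect hmp ξ n (expLp γ u) (expLp γ w) := by
    intro u w
    let x := Finsupp.linearCombination ℝ f u
    let y : ℤ → H := fun n => Finsupp.linearCombination ℝ f (translate n w)
    have htr0 : translate 0 w = w := by
      simp only [translate, add_zero]; exact Finsupp.mapDomain_id
    have hy0 : y 0 = Finsupp.linearCombination ℝ f w := by simp only [y, htr0]
    have hyn : ∀ n, ‖y n‖ = ‖y 0‖ := fun n => by
      rw [hy0]; exact norm_linearCombination_translate hf n w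
    let E : ℝ := Real.exp (-(‖x‖ ^ 2 + ‖y 0‖ ^ 2) / 2)
    have hE1 : E ≤ 1 := Real.exp_le_one_iff.2 (by nlinarith [sq_nonneg ‖x‖, sq_nonneg ‖y 0‖])
    have hU : ∀ n, inner ℂ (expLp γ u) (Lp.compMeasurePreservingₗᵢ ℂ _ (hmp n) (expLp γ w)) =
        ((E * Real.exp (inner ℝ x (y n)) : ℝ) : ℂ) := fun n => by
      rw [inner_expLp_compMeasurePreserving hf hchar hmp, ← hy0]
    have hshift0 : Lp.compMeasurePreservingₗᵢ ℂ _ (hmp 0) (expLp γ w) = expLp γ w := by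
      refine Lp.ext ?_
      filter_upwards [Lp.coeFn_compMeasurePreserving (expLp γ w) (hmp 0)] with ω hω
      exact hω
    have hI : inner ℂ (expLp γ u) (expLp γ w) = ((E * Real.exp (inner ℝ x (y 0)) : ℝ) : ℂ) := by
      rw [← hU 0, hshift0]
    have h0 : ∀ v v' : ℤ →₀ ℝ, inner ℂ (expLp γ v) (expLp γ v') =
        ∫ ω, expFun (v' - v) ω ∂γ := by
      intro v v'
      rw [L2.inner_def]
      refine integral_congr_ae ?_
      filter_upwards [coeFn_expLp γ v, coeFn_expLp γ v'] with ω h1 h2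
      rw [h1, h2, RCLike.inner_apply, conj_expFun, ← expFun_add, sub_eq_add_neg]
    -- `expLp γ 0` is the constant `1`, so this is the product of the two means.
    have hP : inner ℂ (expLp γ u) (expLp γ 0) * inner ℂ (expLp γ 0) (expLp γ w) = (E : ℂ) := by
      rw [h0, h0, hchar, hchar, ← Complex.exp_add, Complex.ofReal_exp]
      congr 1
      simp only [zero_sub, sub_zero, map_neg, norm_neg, hy0, x]
      push_cast; ring
    refine ((avgZero_inner_translate hf h u w).const_mul (Real.exp (‖x‖ * ‖y 0‖))).mono
      (fun n => norm_nonneg _) fun n => ?_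
    -- The identity that needs `ξ ∈ {0, 1}`: it turns the limit of covariances into the desired
    -- mixture of correlations.
    have hβ : (1 - ξ) * Real.exp (inner ℝ x (y 0)) + ξ =
        Real.exp ((1 - ξ) * inner ℝ x (y 0)) := by
      rcases hξ with rfl | rfl <;> simp
    have hle : ∀ n, inner ℝ x (y n) ≤ ‖x‖ * ‖y 0‖ := fun n => by
      rw [← hyn n]; exact real_inner_le_norm x (y n)
    have hle' : (1 - ξ) * inner ℝ x (y 0) ≤ ‖x‖ * ‖y 0‖ := by
      rcases hξ with rfl | rfl
      · simpa using hle 0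
      · simp; positivity
    have hD : corrDefect hmp ξ n (expLp γ u) (expLp γ w) =
        E * |Real.exp (inner ℝ x (y n)) - Real.exp ((1 - ξ) * inner ℝ x (y 0))| := by
      have hE0 : 0 < E := Real.exp_pos _
      have h1 : ((E * Real.exp (inner ℝ x (y n)) : ℝ) : ℂ) - ((1 - ξ) *
          ((E * Real.exp (inner ℝ x (y 0)) : ℝ) : ℂ) + ξ * E) = ((E * (Real.exp (inner ℝ x (y n)) -
            ((1 - ξ) * Real.exp (inner ℝ x (y 0)) + ξ)) : ℝ) : ℂ) := by
        push_cast; ring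
      rw [corrDefect, hU, hI, hP, h1, ← hβ, Complex.norm_real, Real.norm_eq_abs, abs_mul,
        abs_of_pos hE0]
    rw [hD]
    calc _ ≤ 1 * (Real.exp (‖x‖ * ‖y 0‖) *
          |inner ℝ x (y n) - (1 - ξ) * inner ℝ x (y 0)|) := by
          gcongr
          exact abs_exp_sub_exp_le (hle n) hle'
      _ = _ := by rw [one_mul, hy0]
  have hdense := span_expLp_topologicalClosure γ
  -- Density is applied in one argument at a time, the other staying fixed.
  have hright : ∀ u (g' : Lp ℂ 2 γ), AvgZero F fun n => corrDefect hmp ξ n (expLp γ u) g' := by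
    intro u
    refine AvgZero.of_dense_span ((1 + |1 - ξ| + |ξ| * ‖expLp γ 0‖ ^ 2) * ‖expLp γ u‖)
      (fun n x => norm_nonneg _) (fun n x y => ?_) (fun n a x => ?_)
      (fun n x => corrDefect_le hmp ξ n _ x) hdense ?_
    · refine le_trans (le_of_eq ?_) (norm_add_le _ _)
      rw [corrDefect, map_add, inner_add_right, inner_add_right, inner_add_right]
      congr 1; ring
    · rw [corrDefect, corrDefect, ← norm_mul, map_smul, inner_smul_right, inner_smul_right,
        inner_smul_right]
      refine le_of_eq (congrArg _ ?_)
      ring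
    · rintro _ ⟨w, rfl⟩
      exact hexp u w
  refine AvgZero.of_dense_span (d := fun n g => corrDefect hmp ξ n g g')
    ((1 + |1 - ξ| + |ξ| * ‖expLp γ 0‖ ^ 2) * ‖g'‖)
    (fun n x => norm_nonneg _) (fun n x y => ?_) (fun n a x => ?_)
    (fun n x => (corrDefect_le hmp ξ n x g').trans_eq (by ring)) hdense ?_ g
  · refine le_trans (le_of_eq ?_) (norm_add_le _ _)
    simp only [corrDefect]
    rw [inner_add_left, inner_add_left, inner_add_left]
    congr 1; ring
  · simp only [corrDefect]
    rw [← Complex.norm_conj a, ← norm_mul, inner_smul_left, inner_smul_left, inner_smul_left]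
    refine le_of_eq (congrArg _ ?_)
    ring
  · rintro _ ⟨u, rfl⟩
    exact hright u g'

/-- Convergence of the covariances, in the averaged sense along `F`, implies convergence of the
correlations of measurable sets. -/
theorem avgZero_correlation {F : ℕ → Finset ℤ}
    (hf : ∀ m n, inner ℝ (f n) (f m) = c (m - n))
    (hchar : ∀ u, ∫ ω, expFun u ω ∂γ =
      Complex.exp (-(‖Finsupp.linearCombination ℝ f u‖ : ℂ) ^ 2 / 2))
    {ξ : ℝ} (hξ : ξ = 0 ∨ ξ = 1)
    (h : ∀ a, AvgZero F fun n => |c (n + a) - (1 - ξ) * c a|) {A B : Set (ℤ → ℝ)}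
    (hA : MeasurableSet A) (hB : MeasurableSet B) :
    AvgZero F fun n => |γ.real (A ∩ ⇑(shift ^ n) ⁻¹' B) -
      ((1 - ξ) * γ.real (A ∩ B) + ξ * (γ.real A * γ.real B))| := by
  have hmp := measurePreserving_shift_zpow (γ := γ) hf hchar
  let χ : ∀ {S : Set (ℤ → ℝ)}, MeasurableSet S → Lp ℂ 2 γ := fun hS =>
    indicatorConstLp 2 hS (measure_ne_top γ _) (1 : ℂ)
  have hχ : ∀ {S : Set (ℤ → ℝ)} (hS : MeasurableSet S), χ hS =ᵐ[γ] S.indicator fun _ => (1 : ℂ) :=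
    fun hS => indicatorConstLp_coeFn
  have hind : ∀ {S S' : Set (ℤ → ℝ)}, MeasurableSet S → MeasurableSet S' →
      ∫ ω in S, S'.indicator (fun _ => (1 : ℂ)) ω ∂γ = γ.real (S ∩ S') := by
    intro S S' hS hS'
    rw [setIntegral_indicator hS']
    simp [Measure.real]
  have h1 : ∀ n, inner ℂ (χ hA) (Lp.compMeasurePreservingₗᵢ ℂ _ (hmp n) (χ hB)) =
      γ.real (A ∩ ⇑(shift ^ n) ⁻¹' B) := by
    intro n
    rw [L2.inner_indicatorConstLp_one, ← hind hA ((hmp n).measurable hB)]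
    refine integral_congr_ae (ae_restrict_of_ae ?_)
    filter_upwards [Lp.coeFn_compMeasurePreserving (χ hB) (hmp n),
      (hmp n).quasiMeasurePreserving.ae_eq_comp (hχ hB)] with ω h2 h3
    exact h2.trans h3
  have h2 : inner ℂ (χ hA) (χ hB) = γ.real (A ∩ B) := by
    rw [L2.inner_indicatorConstLp_one, ← hind hA hB]
    exact integral_congr_ae (ae_restrict_of_ae (hχ hB))
  have h3 : ∀ {S : Set (ℤ → ℝ)} (hS : MeasurableSet S),
      inner ℂ (χ hS) (expLp γ 0) = γ.real S := by
    intro S hS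
    rw [L2.inner_indicatorConstLp_one]
    have : ∫ ω in S, expLp γ 0 ω ∂γ = ∫ ω in S, (1 : ℂ) ∂γ := by
      refine integral_congr_ae (ae_restrict_of_ae ?_)
      filter_upwards [coeFn_expLp γ 0] with ω hω
      rw [hω, expFun_zero]
    rw [this]
    simp [Measure.real]
  have h4 : inner ℂ (expLp γ 0) (χ hB) = γ.real B := by
    rw [← inner_conj_symm, h3 hB, Complex.conj_ofReal]
  refine (avgZero_corrDefect hf hchar hmp hξ h (χ hA) (χ hB)).mono (fun n => abs_nonneg _)
    fun n => ?_
  rw [corrDefect, h1, h2, h3 hA, h4, ← Real.norm_eq_abs, ← Complex.norm_real]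
  push_cast
  exact le_rfl

end Correlation

/-! ### The auxiliary polynomial and weak mixing. -/

/-- The coefficient of degree `D` isolates the adjoined power; what remains is a relation among the
`v j`. -/
theorem sum_option_smul_ne_zero {N : ℕ} {v : Fin N → Polynomial ℤ}
    (hv : LinearIndependent ℚ fun j => (v j).map (Int.castRingHom ℚ)) {D : ℕ}
    (hD : ∀ j, (v j).natDegree < D) (c : Option (Fin N) → ℤ) (hc : c ≠ 0) :
    ∑ i, c i • (i.elim (Polynomial.X ^ D) v : Polynomial ℤ) ≠ 0 := by
  intro h
  rw [Fintype.sum_option] at h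
  simp only [Option.elim_none, Option.elim_some] at h
  have hnone : c none = 0 := by
    have := congrArg (fun q => Polynomial.coeff q D) h
    simpa [Polynomial.finsetSum_coeff, Polynomial.coeff_smul,
      Polynomial.coeff_eq_zero_of_natDegree_lt (hD _)] using this
  rw [hnone, zero_smul, zero_add] at h
  have h2 := congrArg (Polynomial.map (Int.castRingHom ℚ)) h
  rw [Polynomial.map_sum, Polynomial.map_zero] at h2
  have h3 := Fintype.linearIndependent_iff.1 hv (fun j => (c (some j) : ℚ)) (by
    rw [← h2]
    refine Finset.sum_congr rfl fun j _ => ?_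
    rw [zsmul_eq_mul, Polynomial.map_mul, Polynomial.map_intCast, Polynomial.smul_eq_C_mul]
    simp)
  apply hc
  funext i
  cases i with
  | none => exact hnone
  | some j => exact_mod_cast h3 j

/-- A measure with nonnegative Fourier coefficients tending to zero along all translates of some
sequence defines a weakly mixing Gaussian system. -/
theorem isWeaklyMixing_shift {H : Type*} [NormedAddCommGroup H] [InnerProductSpace ℝ H]
    {f : ℤ → H} {c : ℤ → ℝ} {γ : Measure (ℤ → ℝ)} [IsProbabilityMeasure γ]
    (hf : ∀ m n, inner ℝ (f n) (f m) = c (m - n))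
    (hchar : ∀ u, ∫ ω, expFun u ω ∂γ =
      Complex.exp (-(‖Finsupp.linearCombination ℝ f u‖ : ℂ) ^ 2 / 2))
    {ρ : Measure UnitAddCircle} [IsFiniteMeasure ρ] (hc : ∀ n, ∫ x, fourier n x ∂ρ = c n)
    (hc0 : ∀ n, 0 ≤ c n) {s : ℕ → ℤ} (hs : ∀ a, Tendsto (fun k => c (s k + a)) atTop (𝓝 0)) :
    IsWeaklyMixing shift γ := by
  refine ⟨by simpa using measurePreserving_shift_zpow hf hchar 1, fun A B hA hB => ?_⟩
  let F : ℕ → Finset ℤ := fun M => (Finset.Icc 1 M).map Nat.castEmbedding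
  -- The case `ξ = 1`; nonnegativity of `c` removes the absolute values.
  have hF : ∀ a, AvgZero F fun n => |c (n + a) - (1 - 1) * c a| := by
    intro a
    have h1 := tendsto_average_fourierCoeff (ρ := ρ) (s := s) (fun a => by
      simp only [hc]
      exact_mod_cast (Complex.continuous_ofReal.tendsto 0).comp (hs a)) a
    have h2 := (Complex.continuous_re.tendsto 0).comp h1
    refine (h2.congr fun M => ?_)
    simp only [Function.comp, hc, F, Finset.card_map, Finset.sum_map, Nat.castEmbedding_apply,
      sub_self, zero_mul, sub_zero, abs_of_nonneg (hc0 _), Nat.card_Icc, Nat.add_sub_cancel]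
    rw [← Complex.ofReal_natCast, ← Complex.ofReal_sum, ← Complex.ofReal_inv,
      ← Complex.ofReal_mul, Complex.ofReal_re]
  refine (avgZero_correlation hf hchar (.inr rfl) hF hA hB).congr fun M => ?_
  simp only [F, Finset.card_map, Finset.sum_map, Nat.castEmbedding_apply, Nat.card_Icc,
    Nat.add_sub_cancel, zpow_natCast, Equiv.Perm.coe_pow, one_div, sub_self, zero_mul, zero_add,
    one_mul]

end GaussianSystem

end

/-! ### Assembly of the theorem. -/

theorem theorem3 (N : ℕ) (hN : 1 ≤ N)
    (m : ℕ → ℕ) (hm_pos : ∀ k, 1 ≤ k → 0 < m k) (hm_mono : StrictMonoOn m (Set.Ici 1))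
    (hm_dvd : ∀ k, 1 ≤ k → k ! ∣ m k)
    (v : Fin N → Polynomial ℤ)
    (hv_indep : LinearIndependent ℚ fun j => (v j).map (Int.castRingHom ℚ))
    (hv_zero : ∀ j, (v j).eval 0 = 0) :
    ∃ r : ℕ → ℕ, StrictMono r ∧ (∀ k, 1 ≤ r k) ∧
      ∀ ξ : Fin N → ℝ, (∀ j, ξ j = 0 ∨ ξ j = 1) →
        ∃ (ρ : Measure UnitAddCircle) (γ : Measure (ℤ → ℝ)),
          IsFiniteMeasure ρ ∧ GaussianSystem.IsSymmetric ρ ∧ ρ ≠ 0 ∧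
          GaussianSystem.IsGaussianMeasureOf ρ γ ∧
          GaussianSystem.IsWeaklyMixing GaussianSystem.shift γ ∧
          ∀ (j : Fin N) (A B : Set (ℤ → ℝ)), MeasurableSet A → MeasurableSet B →
            Tendsto
              (fun k : ℕ =>
                γ.real (A ∩ ⇑(GaussianSystem.shift ^ (v j).eval (m (r k) : ℤ)) ⁻¹' B))
              atTop
              (𝓝 ((1 - ξ j) * γ.real (A ∩ B) + ξ j * (γ.real A * γ.real B))) := by

  classical
  -- The `+ 1` puts `D` above every degree and makes `X ^ D` vanish at `0` in all cases.
  let D : ℕ := ∑ j, (v j).natDegree + 1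
  let p : Option (Fin N) → Polynomial ℤ := fun i => i.elim (Polynomial.X ^ D) v
  have hp0 : ∀ i, (p i).eval 0 = 0 := by
    rintro (_ | j)
    · simp [p, D]
    · exact hv_zero j
  have hD : ∀ j, (v j).natDegree < D := fun j =>
    Nat.lt_succ_of_le (Finset.single_le_sum (f := fun j => (v j).natDegree)
      (fun _ _ => Nat.zero_le _) (Finset.mem_univ j))
  obtain ⟨r, hr, hr1, hδ⟩ := GaussianSystem.exists_subsequence_approx hp0
    (GaussianSystem.sum_option_smul_ne_zero hv_indep hD) hm_mono hm_dvd
  refine ⟨r, hr, hr1, fun ξ hξ => ?_⟩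
  -- The adjoined power always receives target `1/2`, whatever `ξ` is, to secure weak mixing.
  obtain ⟨δ, hδ0, hδ1, hδ2, hδ3⟩ := hδ fun i => i.elim true fun j => decide (ξ j = 1)
  obtain ⟨ρ, c, _, hc, hlim⟩ := GaussianSystem.exists_measure_cosProduct hδ0
  have hcs : ∀ i a, Tendsto (fun k => c ((p i).eval (m (r k) : ℤ) + a)) atTop
      (𝓝 ((if i.elim true (fun j => decide (ξ j = 1)) then 0 else 1) * c a)) := fun i a =>
    GaussianSystem.tendsto_cosProduct hlim hδ0 (hδ1 i) (hδ2 i) (hδ3 i) a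
  have hc0 : ∀ n, 0 ≤ c n := fun n => ge_of_tendsto' (hlim n) fun L =>
    Finset.prod_nonneg fun l _ => GaussianSystem.cosFactor_nonneg _
  have hcneg : ∀ n, c (-n) = c n := fun n => by
    refine tendsto_nhds_unique (hlim (-n)) ?_
    simpa [GaussianSystem.cosFactor_neg] using hlim n
  obtain ⟨H, _, _, _, f, hf⟩ := GaussianSystem.exists_hilbert_fourier ρ hc
  obtain ⟨γ, _, hL, hcov, hchar⟩ := GaussianSystem.exists_gaussianMeasure f
  refine ⟨ρ, γ, inferInstance, fun n => by rw [hc, hc, hcneg], IsProbabilityMeasure.ne_zero ρ,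
    GaussianSystem.isGaussianMeasureOf hc hf hL hcov hchar,
    GaussianSystem.isWeaklyMixing_shift hf hchar hc hc0
      (s := fun k => (p none).eval (m (r k) : ℤ)) fun a => by simpa using hcs none a,
    fun j A B hA hB => ?_⟩
  have havg := GaussianSystem.avgZero_correlation hf hchar (hξ j)
    (F := fun k => {(v j).eval (m (r k) : ℤ)}) (fun a => by
      rw [GaussianSystem.AvgZero.singleton_iff]
      have := ((hcs (some j) a).sub_const ((1 - ξ j) * c a)).abs
      rcases hξ j with h | h <;> simpa [h, p] using this) hA hB
  rw [GaussianSystem.AvgZero.singleton_iff] at havg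
  rw [← tendsto_sub_nhds_zero_iff]
  exact (tendsto_zero_iff_abs_tendsto_zero _).2 havg
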